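/- For a finite graph $G$, let $d(G)$ be its domination number, that is, the least size of a vertex set $D$ such that every vertex outside $D$ has a neighbour in $D$, and let $a(G)$ be its acyclic chromatic number, that is, the least number of colours in a proper vertex colouring in which the union of any two colour classes induces a forest. \textsc{Diameter} is the problem of computing the length of a longest shortest path of a given undirected, unweighted, connected graph with $n$ vertices and $m$ edges; it is parameterized by $a$ and $d$ if the instance consists of the graph together with the values $a=a(G)$ and $d=d(G)$. The Strong Exponential Time Hypothesis (SETH) states that for every $\delta<1$ there is a $k$ such that $k$-SAT cannot be decided in time $2^{\delta N}\cdot(N+M)^{O(1)}$ on formulas with $N$ variables and $M$ clauses. Algorithms are deterministic random access machine programs whose running time is measured by the logarithmic cost criterion. **Theorem.** Assume SETH. Then for every computable function $f\colon\mathbb N\times\mathbb N\to\mathbb N$ and every $\varepsilon>0$ there is no algorithm that solves \textsc{Diameter}, parameterized by acyclic chromatic number $a$ and domination number $d$, in time $f(a,d)\cdot(n+m)^{2-\varepsilon}$. -/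

import Mathlib

/-! ## Random access machines with logarithmic cost

Memory is an infinite array of registers, each holding a natural number. Programs are in
structured form (assignment, sequence, conditional, loop); jumps can be simulated with a constant
factor overhead. Every value that is computed or fetched is charged its bit length plus one. -/

/-- The contents of the memory: register `i` holds `s i`. -/
abbrev RamMem : Type := ℕ → ℕ

/-- The arithmetical, bitwise and comparison operations of the machine. -/
inductive RamOp : Type
  | add | sub | mul | div | mod | band | bor | bxor | shl | shr | eq | lt

/-- Subtraction is truncated, division by zero gives zero, comparisons give `1` or `0`. -/
def RamOp.eval : RamOp → ℕ → ℕ → ℕ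
  | .add, x, y => x + y
  | .sub, x, y => x - y
  | .mul, x, y => x * y
  | .div, x, y => x / y
  | .mod, x, y => x % y
  | .band, x, y => x &&& y
  | .bor, x, y => x ||| y
  | .bxor, x, y => x ^^^ y
  | .shl, x, y => x <<< y
  | .shr, x, y => x >>> y
  | .eq, x, y => if x = y then 1 else 0
  | .lt, x, y => if x < y then 1 else 0

/-- Expressions: constants, the contents of the register with a computed address (indirect
addressing), and operations. -/
inductive RamExpr : Type
  | lit (x : ℕ)
  | read (addr : RamExpr)
  | op (o : RamOp) (e₁ e₂ : RamExpr)

/-- The value of an expression in a memory. -/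
def RamExpr.eval (s : RamMem) : RamExpr → ℕ
  | .lit x => x
  | .read a => s (a.eval s)
  | .op o e₁ e₂ => o.eval (e₁.eval s) (e₂.eval s)

/-- The logarithmic cost of evaluating an expression: each node costs one plus the bit length
(`Nat.size`) of its value; in particular fetching a register is charged for the address and for
the contents, and an operation for its operands and its result. -/
def RamExpr.cost (s : RamMem) : RamExpr → ℕ
  | .lit x => 1 + Nat.size x
  | .read a => a.cost s + (1 + Nat.size (s (a.eval s)))
  | .op o e₁ e₂ =>
      e₁.cost s + e₂.cost s + (1 + Nat.size (o.eval (e₁.eval s) (e₂.eval s)))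

/-- Programs. `store a e` writes the value of `e` into the register whose address is the value
of `a`. A test succeeds if the value of the expression is not zero. -/
inductive RamProg : Type
  | skip
  | store (addr e : RamExpr)
  | seq (P Q : RamProg)
  | ite (e : RamExpr) (P Q : RamProg)
  | loop (e : RamExpr) (P : RamProg)

/-- `RamExec P s c s'`: program `P`, started in memory `s`, halts with memory `s'` at total
cost `c`. -/
inductive RamExec : RamProg → RamMem → ℕ → RamMem → Prop
  | skip (s : RamMem) : RamExec .skip s 1 s
  | store (a e : RamExpr) (s : RamMem) :
      RamExec (.store a e) s (1 + a.cost s + e.cost s)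
        (Function.update s (a.eval s) (e.eval s))
  | seq {P Q : RamProg} {s₁ s₂ s₃ : RamMem} {c₁ c₂ : ℕ} :
      RamExec P s₁ c₁ s₂ → RamExec Q s₂ c₂ s₃ → RamExec (.seq P Q) s₁ (1 + c₁ + c₂) s₃
  | ite_true {e : RamExpr} {P Q : RamProg} {s s' : RamMem} {c : ℕ} :
      e.eval s ≠ 0 → RamExec P s c s' → RamExec (.ite e P Q) s (1 + e.cost s + c) s'
  | ite_false {e : RamExpr} {P Q : RamProg} {s s' : RamMem} {c : ℕ} :
      e.eval s = 0 → RamExec Q s c s' → RamExec (.ite e P Q) s (1 + e.cost s + c) s'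
  | loop_true {e : RamExpr} {P : RamProg} {s₁ s₂ s₃ : RamMem} {c₁ c₂ : ℕ} :
      e.eval s₁ ≠ 0 → RamExec P s₁ c₁ s₂ → RamExec (.loop e P) s₂ c₂ s₃ →
        RamExec (.loop e P) s₁ (1 + e.cost s₁ + c₁ + c₂) s₃
  | loop_false {e : RamExpr} {P : RamProg} {s : RamMem} :
      e.eval s = 0 → RamExec (.loop e P) s (1 + e.cost s) s

/-- The initial memory: the input occupies the first registers, all others hold zero. -/
def RamMem.ofInput (input : List ℕ) : RamMem := fun i => input.getD i 0

/-- On the given input, `P` halts within the given time and leaves `output` in register `0`. -/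
def RamProg.Computes (P : RamProg) (input : List ℕ) (time : ℝ) (output : ℕ) : Prop :=
  ∃ (c : ℕ) (s : RamMem),
    RamExec P (RamMem.ofInput input) c s ∧ (c : ℝ) ≤ time ∧ s 0 = output

/-! ## Satisfiability and the Strong Exponential Time Hypothesis -/

/-- Formulas in conjunctive normal form over `n` variables: lists of clauses, a clause being a list
of literals. The literal `(x, b)` demands that variable `x` has the truth value `b`. -/
abbrev CnfFormula (n : ℕ) : Type := List (List (Fin n × Bool))

/-- Some truth assignment makes a literal of every clause true. -/
def CnfFormula.Satisfiable {n : ℕ} (φ : CnfFormula n) : Prop :=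
  ∃ β : Fin n → Bool, ∀ C ∈ φ, ∃ l ∈ C, β l.1 = l.2

/-- The number of variables and the number of clauses, followed by the clauses; a clause is its
length followed by its literals, the literal `(x, b)` being the number `2 x + b`. -/
def CnfFormula.encode {n : ℕ} (φ : CnfFormula n) : List ℕ :=
  n :: φ.length ::
    φ.flatMap fun C => C.length :: C.map fun l => 2 * (l.1 : ℕ) + (if l.2 then 1 else 0)

open Classical in
/-- `P` decides `k`-SAT in time `A * 2 ^ (δ * n) * (n + |φ| + 1) ^ c`, where `n` is the number of
variables and `|φ|` is the number of clauses. -/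
def SolvesKSat (P : RamProg) (k : ℕ) (δ : ℝ) (A c : ℕ) : Prop :=
  ∀ (n : ℕ) (φ : CnfFormula n), (∀ C ∈ φ, C.length ≤ k) →
    P.Computes φ.encode
      ((A : ℝ) * (2 : ℝ) ^ (δ * (n : ℝ)) * ((n + φ.length + 1 : ℕ) : ℝ) ^ c)
      (if φ.Satisfiable then 1 else 0)

/-- The Strong Exponential Time Hypothesis: for every `δ < 1` there is a `k` such that `k`-SAT
cannot be solved in time `2 ^ (δ n) (n + |φ|) ^ O(1)`. -/
def StrongExponentialTimeHypothesis : Prop :=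
  ∀ δ : ℝ, δ < 1 → ∃ k : ℕ, ¬ ∃ (P : RamProg) (A c : ℕ), SolvesKSat P k δ A c

/-! ## Graph parameters and the problem -/

/-- The domination number: the least size of a set `D` of vertices such that every vertex is in `D`
or has a neighbour in `D`. -/
noncomputable def dominationNumber {V : Type*} (G : SimpleGraph V) : ℕ :=
  sInf {d : ℕ | ∃ D : Finset V, D.card = d ∧ ∀ v, v ∈ D ∨ ∃ u ∈ D, G.Adj u v}

/-- The acyclic chromatic number: the least number of colours in a proper colouring in which the
union of any two colour classes induces a forest. -/
noncomputable def acyclicChromaticNumber {V : Type*} (G : SimpleGraph V) : ℕ :=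
  sInf {a : ℕ | ∃ C : G.Coloring (Fin a),
    ∀ i j : Fin a, (G.induce {v | C v = i ∨ C v = j}).IsAcyclic}

/-- The list `L` contains every edge of `G` exactly once (in one of its two orientations). -/
def IsEdgeList {n : ℕ} (G : SimpleGraph (Fin n)) (L : List (Fin n × Fin n)) : Prop :=
  (L.map fun e => s(e.1, e.2)).Nodup ∧ ∀ u v, s(u, v) ∈ L.map (fun e => s(e.1, e.2)) ↔ G.Adj u v

/-- The input for Diameter: the numbers of vertices and edges, the parameters `a` and `d`, and the
edges. -/
def encodeDiameterInstance (n : ℕ) (L : List (Fin n × Fin n)) (a d : ℕ) : List ℕ :=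
  n :: L.length :: a :: d :: L.flatMap fun e => [(e.1 : ℕ), (e.2 : ℕ)]

/-- `P` solves Diameter, parameterized by the acyclic chromatic number `a` and the domination
number `d`, in time `f a d * (n + m) ^ p`: given a connected graph with `n` vertices and `m` edges
(by its edges in any order) and the values of `a` and `d`, it computes the diameter. -/
def SolvesDiameterAcnDom (P : RamProg) (f : ℕ → ℕ → ℕ) (p : ℝ) : Prop :=
  ∀ (n : ℕ) (G : SimpleGraph (Fin n)) (L : List (Fin n × Fin n)),
    G.Connected → IsEdgeList G L →
      P.Computes
        (encodeDiameterInstance n L (acyclicChromaticNumber G) (dominationNumber G))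
        ((f (acyclicChromaticNumber G) (dominationNumber G) : ℝ) * ((n + L.length : ℕ) : ℝ) ^ p)
        G.diam

/-! The proof is a split-and-list reduction from `k`-SAT to instances of Diameter with a = d = 5.
Split the n variables into two halves and list the 2^⌈n/2⌉ assignments of each half. A formula is
satisfiable iff some assignment x of the first half and some y of the second leave no clause
unsatisfied by both (`CnfFormula.satisfiable_iff`). In the graph, x is linked by a path of length
two to every clause that it leaves unsatisfied, so a common unsatisfied clause puts x and y at
distance at most 4. A path of five hubs yields routes of length 6 between assignments of opposite
halves and of length at most 5 between all other vertices. A potential function shows that without a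
common unsatisfied clause the distance of x and y is exactly 6. Hence the diameter is 6 iff the
formula is satisfiable, and at most 5 otherwise (`RedVertex.diam_graph_eq_six_iff`).

Both parameters are constant. The hubs dominate, and five vertices with disjoint closed
neighbourhoods forbid a smaller dominating set. The subdivision vertices allow a five-colouring in
which no vertex has two neighbours of the same higher colour, which makes it acyclic, and a
five-clique gives the lower bound. The factor f(a, d) thus becomes the constant f(5, 5). With M
clauses the graph has O(M 2^(n/2)) vertices and edges, so time (n + m)^(2-ε) turns into 2^((1-ε/2)n)
times a polynomial for ε ≤ 1, against SETH.

The remaining work is to run the reduction on the machine. All numbers written have at most W = n +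
M + k + 20 bits, so a fixed expression without left shifts costs O(W), and the instance is produced
in time O(M 2^(n/2) W) for fixed k (`RedData.runs_prepare`). It is written behind the saved input,
and the Diameter program is run there with all its addresses shifted, which costs a further factor
O(W) (`RamExec.shift`). -/

/-! ## Cost of expressions -/

/-- The expression does not use the left shift, the only operation whose result can be much longer
than its operands. -/
def RamExpr.NoShl : RamExpr → Prop
  | .lit _ => True
  | .read a => a.NoShl
  | .op o e₁ e₂ => o ≠ .shl ∧ e₁.NoShl ∧ e₂.NoShl

/-- If all registers are shorter than `W` bits, the value is shorter than `e.growth * W` bits. -/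
def RamExpr.growth : RamExpr → ℕ
  | .lit x => x.size + 1
  | .read _ => 1
  | .op _ e₁ e₂ => e₁.growth + e₂.growth + 1

/-- If all registers are shorter than `W` bits, the cost is at most `e.weight * W`. -/
def RamExpr.weight : RamExpr → ℕ
  | .lit x => x.size + 1
  | .read a => a.weight + 2
  | .op _ e₁ e₂ => e₁.weight + e₂.weight + (e₁.growth + e₂.growth + 2)

/-- A product may need `a + b` bits; the extra bit covers the comparison of 0 with 0, which gives 1
even when `a = b = 0`. -/
theorem RamOp.eval_lt {o : RamOp} (ho : o ≠ .shl) {x y a b : ℕ} (hx : x < 2 ^ a) (hy : y < 2 ^ b) :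
    o.eval x y < 2 ^ (a + b + 1) := by
  have ha : 2 ^ a ≤ 2 ^ (a + b + 1) := Nat.pow_le_pow_right (by norm_num) (by omega)
  have ha' : 2 ^ a ≤ 2 ^ (a + b) := Nat.pow_le_pow_right (by norm_num) (by omega)
  have hb' : 2 ^ b ≤ 2 ^ (a + b) := Nat.pow_le_pow_right (by norm_num) (by omega)
  have hs : 2 ^ (a + b + 1) = 2 * 2 ^ (a + b) := by ring
  have h1 : 1 < 2 ^ (a + b + 1) := Nat.one_lt_two_pow (by omega)
  cases o with
  | add => simp only [RamOp.eval]; omega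
  | sub => simp only [RamOp.eval]; omega
  | mul =>
    simp only [RamOp.eval]
    have : x * y < 2 ^ a * 2 ^ b := Nat.mul_lt_mul'' hx hy
    rw [← pow_add] at this
    omega
  | div => simp only [RamOp.eval]; exact lt_of_le_of_lt (Nat.div_le_self _ _) (by omega)
  | mod => simp only [RamOp.eval]; exact lt_of_le_of_lt (Nat.mod_le _ _) (by omega)
  | band => simp only [RamOp.eval]; exact lt_of_le_of_lt Nat.and_le_left (by omega)
  | bor =>
    simp only [RamOp.eval]
    exact lt_of_lt_of_le (Nat.or_lt_two_pow (lt_of_lt_of_le hx ha') (lt_of_lt_of_le hy hb'))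
      (by omega)
  | bxor =>
    simp only [RamOp.eval]
    exact lt_of_lt_of_le (Nat.xor_lt_two_pow (lt_of_lt_of_le hx ha') (lt_of_lt_of_le hy hb'))
      (by omega)
  | shl => exact absurd rfl ho
  | shr =>
    simp only [RamOp.eval, Nat.shiftRight_eq_div_pow]
    exact lt_of_le_of_lt (Nat.div_le_self _ _) (by omega)
  | eq => simp only [RamOp.eval]; split_ifs <;> omega
  | lt => simp only [RamOp.eval]; split_ifs <;> omega

theorem RamExpr.eval_lt {s : RamMem} {W : ℕ} (hW : 1 ≤ W) (hs : ∀ x, s x < 2 ^ W) :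
    ∀ {e : RamExpr}, e.NoShl → e.eval s < 2 ^ (e.growth * W)
  | .lit x, _ => by
    simp only [eval, growth]
    exact lt_of_lt_of_le (Nat.lt_size_self x) (Nat.pow_le_pow_right (by norm_num) (by nlinarith))
  | .read a, _ => by simpa [eval, growth] using hs _
  | .op o e₁ e₂, h => by
    have := RamOp.eval_lt h.1 (eval_lt hW hs h.2.1) (eval_lt hW hs h.2.2)
    simp only [eval, growth]
    exact lt_of_lt_of_le this (Nat.pow_le_pow_right (by norm_num) (by nlinarith))

theorem RamExpr.cost_le {s : RamMem} {W : ℕ} (hW : 1 ≤ W) (hs : ∀ x, s x < 2 ^ W) :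
    ∀ {e : RamExpr}, e.NoShl → e.cost s ≤ e.weight * W
  | .lit x, _ => by
    simp only [cost, weight]
    nlinarith
  | .read a, h => by
    have h1 := cost_le hW hs (e := a) h
    have h2 := Nat.size_le.2 (hs (a.eval s))
    simp only [cost, weight]
    nlinarith
  | .op o e₁ e₂, h => by
    have h1 := cost_le hW hs h.2.1
    have h2 := cost_le hW hs h.2.2
    have h3 := Nat.size_le.2 (eval_lt hW hs (e := .op o e₁ e₂) h)
    simp only [eval, growth] at h3
    simp only [cost, weight]
    nlinarith

theorem RamExpr.size_eval_lt_cost (s : RamMem) : ∀ e : RamExpr, (e.eval s).size < e.cost s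
  | .lit x => by simp only [eval, cost]; omega
  | .read a => by simp only [eval, cost]; omega
  | .op o e₁ e₂ => by simp only [eval, cost]; omega

/-! ## Runs with a bound on the cost -/

/-- `P` takes the memory `s` to the memory `s'` at cost at most `c`. -/
def RamProg.Runs (P : RamProg) (s s' : RamMem) (c : ℕ) : Prop :=
  ∃ c' ≤ c, RamExec P s c' s'

theorem RamProg.Runs.mono {P : RamProg} {s s' : RamMem} {c d : ℕ} (h : P.Runs s s' c)
    (hcd : c ≤ d) : P.Runs s s' d :=
  let ⟨c', hc, hr⟩ := h
  ⟨c', hc.trans hcd, hr⟩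

theorem RamProg.Runs.seq {P Q : RamProg} {s₁ s₂ s₃ : RamMem} {c₁ c₂ : ℕ} (h₁ : P.Runs s₁ s₂ c₁)
    (h₂ : Q.Runs s₂ s₃ c₂) : (RamProg.seq P Q).Runs s₁ s₃ (1 + c₁ + c₂) :=
  let ⟨_, hc₁, hr₁⟩ := h₁
  let ⟨_, hc₂, hr₂⟩ := h₂
  ⟨_, by omega, .seq hr₁ hr₂⟩

theorem RamProg.runs_store {a e : RamExpr} {s s' : RamMem} {c : ℕ}
    (hs : s' = Function.update s (a.eval s) (e.eval s)) (hc : 1 + a.cost s + e.cost s ≤ c) :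
    (RamProg.store a e).Runs s s' c :=
  ⟨_, hc, hs ▸ .store a e s⟩

theorem RamProg.runs_store_of_noShl {a e : RamExpr} {s s' : RamMem} {W : ℕ} (hW : 1 ≤ W)
    (hb : ∀ x, s x < 2 ^ W) (ha : a.NoShl) (he : e.NoShl)
    (hs : s' = Function.update s (a.eval s) (e.eval s)) :
    (RamProg.store a e).Runs s s' ((1 + a.weight + e.weight) * W) :=
  runs_store hs (by nlinarith [RamExpr.cost_le hW hb ha, RamExpr.cost_le hW hb he])

/-- The sequence `m` prescribes the memory before each round. There are `T` rounds but `T + 1`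
tests, whence the last summand. -/
theorem RamProg.runs_loop {e : RamExpr} {P : RamProg} {T b c : ℕ} (m : ℕ → RamMem)
    (hb : ∀ j ≤ T, e.cost (m j) ≤ b) (htrue : ∀ j < T, e.eval (m j) ≠ 0)
    (hfalse : e.eval (m T) = 0) (hP : ∀ j < T, P.Runs (m j) (m (j + 1)) c) :
    (RamProg.loop e P).Runs (m 0) (m T) (T * (1 + b + c) + (1 + b)) := by
  induction T generalizing m with
  | zero => exact ⟨_, by have := hb 0 le_rfl; omega, .loop_false hfalse⟩
  | succ T ih =>
    obtain ⟨c₂, hc₂, h₂⟩ := ih (fun j => m (j + 1)) (fun j hj => hb _ (by omega))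
      (fun j hj => htrue _ (by omega)) hfalse (fun j hj => hP _ (by omega))
    obtain ⟨c₁, hc₁, h₁⟩ := hP 0 (by omega)
    have := hb 0 (by omega)
    exact ⟨_, by nlinarith, .loop_true (htrue 0 (by omega)) h₁ h₂⟩

/-! ## Relocation of programs -/

/-- The expression with all addresses increased by the contents of register `r`. -/
def RamExpr.shift (r : ℕ) : RamExpr → RamExpr
  | .lit x => .lit x
  | .read a => .read (.op .add (.read (.lit r)) (a.shift r))
  | .op o e₁ e₂ => .op o (e₁.shift r) (e₂.shift r)

/-- The program with all addresses increased by the contents of register `r`. -/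
def RamProg.shift (r : ℕ) : RamProg → RamProg
  | .skip => .skip
  | .store a e => .store (.op .add (.read (.lit r)) (a.shift r)) (e.shift r)
  | .seq P Q => .seq (P.shift r) (Q.shift r)
  | .ite e P Q => .ite (e.shift r) (P.shift r) (Q.shift r)
  | .loop e P => .loop (e.shift r) (P.shift r)

/-- The memory `t` contains the memory `s` from address `B` on, and `B` in register `r`. -/
def RamMem.Embeds (r B : ℕ) (s t : RamMem) : Prop :=
  t r = B ∧ ∀ x, t (B + x) = s x

theorem Nat.size_add_le (x y : ℕ) : (x + y).size ≤ x.size + y.size + 1 := by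
  rw [Nat.size_le]
  have hx := Nat.lt_size_self x
  have hy := Nat.lt_size_self y
  have h1 : 2 ^ x.size ≤ 2 ^ (x.size + y.size) := Nat.pow_le_pow_right (by norm_num) (by omega)
  have h2 : 2 ^ y.size ≤ 2 ^ (x.size + y.size) := Nat.pow_le_pow_right (by norm_num) (by omega)
  rw [pow_succ]
  omega

theorem RamExpr.eval_shift {r B : ℕ} {s t : RamMem} (h : RamMem.Embeds r B s t) :
    ∀ e : RamExpr, (e.shift r).eval t = e.eval s
  | .lit x => rfl
  | .read a => by
    simp only [shift, eval, RamOp.eval, eval_shift h a, h.1, h.2]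
  | .op o e₁ e₂ => by simp only [shift, eval, eval_shift h e₁, eval_shift h e₂]

/-- The summand with the size of the value strengthens the induction: a shifted read also computes
the address `B + a`, whose length is bounded by those of `B` and of the value of `a`. The factor
pays for fetching `B` and forming this sum once per node. -/
theorem RamExpr.cost_shift_add_size_lt {r B : ℕ} {s t : RamMem} (h : RamMem.Embeds r B s t) :
    ∀ e : RamExpr, (e.shift r).cost t + (e.eval s).size < (2 * B.size + r.size + 6) * e.cost s
  | .lit x => by
    simp only [shift, cost, eval]
    nlinarith
  | .read a => by
    have h1 := cost_shift_add_size_lt h a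
    have h3 := Nat.size_add_le B (a.eval s)
    simp only [shift, cost, eval, RamOp.eval, eval_shift h a, h.1, h.2]
    nlinarith
  | .op o e₁ e₂ => by
    have h1 := cost_shift_add_size_lt h e₁
    have h2 := cost_shift_add_size_lt h e₂
    simp only [shift, cost, eval, eval_shift h e₁, eval_shift h e₂]
    nlinarith

theorem RamExpr.cost_shift_le {r B : ℕ} {s t : RamMem} (h : RamMem.Embeds r B s t) (e : RamExpr) :
    (e.shift r).cost t ≤ (2 * B.size + r.size + 6) * e.cost s := by
  have := cost_shift_add_size_lt h e
  omega

/-- The shifted program writes only to addresses from `B` on, so `r < B` protects the register that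
holds the base. The factor is twice that for expressions, because a store also has to add `B` to its
target address. -/
theorem RamExec.shift {r B : ℕ} (hr : r < B) {P : RamProg} {s s' : RamMem} {c : ℕ}
    (hP : RamExec P s c s') : ∀ {t : RamMem}, RamMem.Embeds r B s t →
      ∃ t', RamMem.Embeds r B s' t' ∧ (P.shift r).Runs t t' ((4 * B.size + 2 * r.size + 12) * c) := by
  induction hP with
  | skip s =>
    intro t h
    exact ⟨t, h, 1, by nlinarith, .skip t⟩
  | store a e s =>
    intro t h
    refine ⟨_, ?_, _, ?_, .store _ _ t⟩
    · simp only [RamExpr.eval, RamOp.eval, RamExpr.eval_shift h, h.1]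
      refine ⟨?_, fun x => ?_⟩
      · rw [Function.update_of_ne (by omega), h.1]
      · by_cases hx : x = a.eval s
        · subst hx; simp
        · rw [Function.update_of_ne (by omega), Function.update_of_ne hx, h.2]
    · have h1 := RamExpr.cost_shift_le h a
      have h2 := RamExpr.cost_shift_le h e
      have h3 := RamExpr.size_eval_lt_cost s a
      have h4 := Nat.size_add_le B (a.eval s)
      simp only [RamExpr.cost, RamExpr.eval, RamOp.eval, RamExpr.eval_shift h, h.1]
      nlinarith
  | seq _ _ ih₁ ih₂ =>
    intro t h
    obtain ⟨t₁, h₁, r₁⟩ := ih₁ h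
    obtain ⟨t₂, h₂, r₂⟩ := ih₂ h₁
    exact ⟨t₂, h₂, (r₁.seq r₂).mono (by nlinarith)⟩
  | ite_true he _ ih =>
    intro t h
    obtain ⟨t₁, h₁, c₁, hc₁, r₁⟩ := ih h
    refine ⟨t₁, h₁, _, ?_, .ite_true (by rwa [RamExpr.eval_shift h]) r₁⟩
    nlinarith [RamExpr.cost_shift_le h ‹RamExpr›]
  | ite_false he _ ih =>
    intro t h
    obtain ⟨t₁, h₁, c₁, hc₁, r₁⟩ := ih h
    refine ⟨t₁, h₁, _, ?_, .ite_false (by rwa [RamExpr.eval_shift h]) r₁⟩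
    nlinarith [RamExpr.cost_shift_le h ‹RamExpr›]
  | loop_true he _ _ ih₁ ih₂ =>
    intro t h
    obtain ⟨t₁, h₁, c₁, hc₁, r₁⟩ := ih₁ h
    obtain ⟨t₂, h₂, c₂, hc₂, r₂⟩ := ih₂ h₁
    refine ⟨t₂, h₂, _, ?_, .loop_true (by rwa [RamExpr.eval_shift h]) r₁ r₂⟩
    nlinarith [RamExpr.cost_shift_le h ‹RamExpr›]
  | loop_false he =>
    intro t h
    refine ⟨t, h, _, ?_, .loop_false (by rwa [RamExpr.eval_shift h])⟩
    nlinarith [RamExpr.cost_shift_le h ‹RamExpr›]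

/-! ## Invariance of the graph parameters -/

theorem SimpleGraph.edist_map_le {V W : Type*} {G : SimpleGraph V} {H : SimpleGraph W}
    (f : G →g H) (u v : V) : H.edist (f u) (f v) ≤ G.edist u v :=
  le_iInf fun p => (SimpleGraph.Walk.edist_le (p.map f)).trans (by simp)

theorem SimpleGraph.Iso.ediam_le {V W : Type*} {G : SimpleGraph V} {H : SimpleGraph W}
    (e : G ≃g H) : G.ediam ≤ H.ediam :=
  SimpleGraph.ediam_le_of_edist_le fun u v => by
    have := SimpleGraph.edist_map_le e.symm.toHom (e u) (e v)
    have h : ∀ x, e.symm.toHom (e x) = x := fun x => e.symm_apply_apply x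
    rw [h, h] at this
    exact this.trans SimpleGraph.edist_le_ediam

theorem SimpleGraph.Iso.diam_eq {V W : Type*} {G : SimpleGraph V} {H : SimpleGraph W}
    (e : G ≃g H) : G.diam = H.diam := by
  unfold SimpleGraph.diam
  rw [le_antisymm e.ediam_le e.symm.ediam_le]

theorem SimpleGraph.Iso.exists_dominating {V W : Type*} {G : SimpleGraph V} {H : SimpleGraph W}
    (e : G ≃g H) {d : ℕ} (h : ∃ D : Finset V, D.card = d ∧ ∀ v, v ∈ D ∨ ∃ u ∈ D, G.Adj u v) :
    ∃ D : Finset W, D.card = d ∧ ∀ v, v ∈ D ∨ ∃ u ∈ D, H.Adj u v := by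
  obtain ⟨D, hD, h⟩ := h
  refine ⟨D.map e.toEquiv.toEmbedding, by simpa using hD, fun w => ?_⟩
  rcases h (e.symm w) with h | ⟨u, hu, hadj⟩
  · exact Or.inl (Finset.mem_map.2 ⟨_, h, e.apply_symm_apply w⟩)
  · refine Or.inr ⟨e u, Finset.mem_map.2 ⟨_, hu, rfl⟩, ?_⟩
    rw [← e.apply_symm_apply w]
    exact e.map_adj_iff.2 hadj

theorem dominationNumber_eq_of_iso {V W : Type*} {G : SimpleGraph V} {H : SimpleGraph W}
    (e : G ≃g H) : dominationNumber G = dominationNumber H := by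
  unfold dominationNumber
  congr 1
  ext d
  exact ⟨e.exists_dominating, e.symm.exists_dominating⟩

/-! ## Bounds for the graph parameters -/

/-- Along a walk the potential rises by at most one per step. -/
theorem SimpleGraph.le_edist_of_potential {V : Type*} {G : SimpleGraph V} (φ : V → ℕ)
    (h : ∀ u v, G.Adj u v → φ v ≤ φ u + 1) (u v : V) : ((φ v - φ u : ℕ) : ℕ∞) ≤ G.edist u v := by
  refine le_iInf fun p => ?_
  suffices φ v ≤ φ u + p.length by
    exact_mod_cast (by omega : φ v - φ u ≤ p.length)
  induction p with
  | nil => simp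
  | cons hadj p ih =>
    have := h _ _ hadj
    simp only [SimpleGraph.Walk.length_cons]
    omega

/-- On a cycle in two colour classes, a vertex of the lower colour has two distinct neighbours on
the cycle, both of the higher colour. The hypothesis forbids this. -/
theorem SimpleGraph.Coloring.isAcyclic_induce {V : Type*} {G : SimpleGraph V} {a : ℕ}
    (C : G.Coloring (Fin a))
    (h : ∀ v u w, G.Adj v u → G.Adj v w → C u = C w → C v < C u → u = w) (i j : Fin a) :
    (G.induce {v | C v = i ∨ C v = j}).IsAcyclic := by
  have main : ∀ (x y : {v | C v = i ∨ C v = j}) (p : (G.induce {v | C v = i ∨ C v = j}).Walk x x),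
      p.IsCycle → (G.induce {v | C v = i ∨ C v = j}).Adj x y → C x < C y → False := by
    intro x y p hp hxy hlt
    have h1 : G.Adj x p.snd := p.adj_snd hp.not_nil
    have h2 : G.Adj x p.penultimate := (p.adj_penultimate hp.not_nil).symm
    have e : ∀ z : {v | C v = i ∨ C v = j}, G.Adj x z → C z = C y := by
      intro z hz
      have hzx := C.valid hz
      have hyx := C.valid (show G.Adj x y from hxy)
      have hx := x.2
      have hy := y.2
      have hz' := z.2
      simp only [Set.mem_ofPred_eq] at hx hy hz'
      grind
    exact hp.snd_ne_penultimate
      (Subtype.ext (h x _ _ h1 h2 ((e _ h1).trans (e _ h2).symm) (by rw [e _ h1]; exact hlt)))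
  classical
  intro x p hp
  have hadj := p.adj_snd hp.not_nil
  rcases lt_trichotomy (C x) (C p.snd) with hlt | heq | hlt
  · exact main x _ p hp hadj hlt
  · exact C.valid (show G.Adj x p.snd from hadj) heq
  -- The base point has the higher colour here, so the cycle is restarted at its second vertex.
  · exact main _ x (p.rotate _ (p.getVert_mem_support 1)) (hp.rotate (p.getVert_mem_support 1)) hadj.symm hlt

/-- The colouring gives the upper bound; the clique `K` needs `a` colours in any proper colouring.
-/
theorem acyclicChromaticNumber_eq {V : Type*} {G : SimpleGraph V} {a : ℕ}
    (C : G.Coloring (Fin a))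
    (h : ∀ v u w, G.Adj v u → G.Adj v w → C u = C w → C v < C u → u = w)
    (K : Fin a → V) (hK : ∀ i j, i ≠ j → G.Adj (K i) (K j)) : acyclicChromaticNumber G = a := by
  refine le_antisymm (Nat.sInf_le ⟨C, C.isAcyclic_induce h⟩)
    (le_csInf ⟨a, C, C.isAcyclic_induce h⟩ ?_)
  rintro b ⟨C', -⟩
  have hinj : Function.Injective (fun i => C' (K i)) := by
    intro i j hij
    by_contra hne
    exact C'.valid (hK i j hne) hij
  simpa using Fintype.card_le_of_injective _ hinj

theorem acyclicChromaticNumber_eq_of_iso {V W : Type*} {G : SimpleGraph W} {H : SimpleGraph V}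
    (e : G ≃g H) {a : ℕ} (C : H.Coloring (Fin a))
    (h : ∀ v u w, H.Adj v u → H.Adj v w → C u = C w → C v < C u → u = w)
    (K : Fin a → V) (hK : ∀ i j, i ≠ j → H.Adj (K i) (K j)) : acyclicChromaticNumber G = a := by
  refine acyclicChromaticNumber_eq (C.comp e.toHom) (fun v u w hu hw hC hlt => e.injective ?_)
    (fun i => e.symm (K i)) fun i j hij => e.symm.map_adj_iff.2 (hK i j hij)
  exact h (e v) (e u) (e w) (e.map_adj_iff.2 hu) (e.map_adj_iff.2 hw) hC hlt

/-! ## The graph of a formula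

The clauses are numbered by `Fin M`. The elements of `Fin K` are the assignments to one half of the
variables, the parity tells which half; `U c x` says that `x` satisfies no literal of clause `c`. -/

/-- The vertices: a core of constant size, clauses (and two dummy clauses), assignments, and the
subdivision vertices between assignments and clauses. -/
inductive RedVertex (M K : ℕ) : Type
  | core (i : Fin 11)
  | clause (j : Fin (M + 2))
  | assign (x : Fin K)
  | sub (c : Fin M) (x : Fin K)

namespace RedVertex

/-- The edges inside the core: a path of five hubs, a clique on five vertices, two leaves. -/
def coreEdges : List (Fin 11 × Fin 11) :=
  [(0, 1), (1, 2), (2, 3), (3, 4), (2, 5), (2, 6), (2, 7), (2, 8), (5, 6), (5, 7), (5, 8), (6, 7),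
    (6, 8), (7, 8), (1, 9), (3, 10)]

variable {M K : ℕ}

/-- The clause vertex joined to `sub c x`. -/
def target (U : ℕ → ℕ → Bool) (M c x : ℕ) : ℕ := if U c x then c else M + x % 2

/-- The edges, each in one orientation. -/
def Arc (U : ℕ → ℕ → Bool) : RedVertex M K → RedVertex M K → Prop
  | core i, core j => (i, j) ∈ coreEdges
  | core i, clause _ => i = 2
  | core i, assign x => (i : ℕ) = 4 * (x % 2)
  | core i, sub _ x => (i : ℕ) = 1 + 2 * (x % 2)
  | clause j, sub c x => (j : ℕ) = target U M c x
  | assign y, sub _ x => y = x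
  | _, _ => False

/-- The graph of the formula. -/
def graph (U : ℕ → ℕ → Bool) (M K : ℕ) : SimpleGraph (RedVertex M K) where
  Adj u v := Arc U u v ∨ Arc U v u
  symm := ⟨fun _ _ h => h.symm⟩
  loopless := ⟨by
    rintro (i | j | x | ⟨c, x⟩) <;> simp only [Arc, or_self, not_false_iff]
    revert i; decide⟩

theorem adj_iff {U : ℕ → ℕ → Bool} {u v : RedVertex M K} :
    (graph U M K).Adj u v ↔ Arc U u v ∨ Arc U v u := Iff.rfl

/-! ### Domination number -/

/-- The hub adjacent to a core vertex. -/
def coreLayer : Fin 11 → Fin 5 := ![0, 1, 2, 3, 4, 2, 2, 2, 2, 1, 3]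

/-- The hub which a vertex equals or is adjacent to. -/
def layer : RedVertex M K → ℕ
  | core i => coreLayer i
  | clause _ => 2
  | assign x => 4 * (x % 2)
  | sub _ x => 1 + 2 * (x % 2)

theorem layer_lt (v : RedVertex M K) : v.layer < 5 := by
  rcases v with i | j | x | ⟨c, x⟩ <;> simp only [layer] <;> omega

/-- The hubs. -/
def hub (i : Fin 5) : RedVertex M K := core (Fin.castLE (by norm_num) i)

theorem eq_or_adj_hub (U : ℕ → ℕ → Bool) (v : RedVertex M K) :
    v = hub ⟨v.layer, v.layer_lt⟩ ∨ (graph U M K).Adj (hub ⟨v.layer, v.layer_lt⟩) v := by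
  rcases v with i | j | x | ⟨c, x⟩
  · have : ∀ i : Fin 11, i = Fin.castLE (by norm_num) (coreLayer i) ∨
        (Fin.castLE (by norm_num) (coreLayer i), i) ∈ coreEdges := by decide
    rcases this i with h | h
    · exact Or.inl (by simpa [hub, layer] using h)
    · exact Or.inr (Or.inl (by simpa [Arc, hub, layer] using h))
  all_goals exact Or.inr (Or.inl (by simp [Arc, hub, layer]))

/-- A partition into five parts each of which contains the closed neighbourhood of a vertex. -/
def part : RedVertex M K → ℕ
  | core i => coreLayer i
  | clause _ => 2
  | assign x => 4 * (x % 2)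
  | sub _ x => 4 * (x % 2)

/-- The hubs dominate. Conversely, a dominating set meets the closed neighbourhoods of the two
leaves 9 and 10, of the clique vertex 5, and of one assignment from each half, and these lie in five
different parts. The bound on `K` provides the two assignments. -/
theorem dominationNumber_graph (U : ℕ → ℕ → Bool) (hK : 2 ≤ K) :
    dominationNumber (graph U M K) = 5 := by
  have hub_inj : Function.Injective (hub : Fin 5 → RedVertex M K) := by
    intro i j h
    simpa [hub, Fin.ext_iff] using h
  have hmem : ∃ D : Finset (RedVertex M K), D.card = 5 ∧
      ∀ v, v ∈ D ∨ ∃ u ∈ D, (graph U M K).Adj u v := by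
    refine ⟨Finset.univ.map ⟨hub, hub_inj⟩, by simp, fun v => ?_⟩
    rcases eq_or_adj_hub U v with h | h
    · exact Or.inl (Finset.mem_map.2 ⟨_, Finset.mem_univ _, h.symm⟩)
    · exact Or.inr ⟨_, Finset.mem_map.2 ⟨_, Finset.mem_univ _, rfl⟩, h⟩
  refine le_antisymm (Nat.sInf_le hmem) (le_csInf ⟨5, hmem⟩ ?_)
  rintro d ⟨D, rfl, hD⟩
  have core_part : ∀ i ∈ ({5, 9, 10} : Finset (Fin 11)), ∀ u : RedVertex M K,
      (graph U M K).Adj u (core i) → u.part = coreLayer i := by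
    have : ∀ i ∈ ({5, 9, 10} : Finset (Fin 11)), ∀ j, (i, j) ∈ coreEdges ∨ (j, i) ∈ coreEdges →
      coreLayer j = coreLayer i := by decide
    -- Only hubs, which have numbers up to 4, have neighbours outside the core.
    have hne : ∀ i ∈ ({5, 9, 10} : Finset (Fin 11)), 4 < (i : ℕ) := by decide
    rintro i hi (j | j | x | ⟨c, x⟩) h
    · simp only [part, this i hi j h.symm]
    all_goals
      have := hne i hi
      simp only [adj_iff, Arc, false_or, Fin.ext_iff] at h
      omega
  have assign_part : ∀ x : Fin K, ∀ u : RedVertex M K,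
      (graph U M K).Adj u (assign x) → u.part = 4 * (x % 2) := by
    have : ∀ i : Fin 11, ∀ b < 2, (i : ℕ) = 4 * b → (coreLayer i : ℕ) = 4 * b := by decide
    rintro x (j | j | y | ⟨c, y⟩) h <;> simp only [adj_iff, Arc, or_false, false_or] at h
    · exact this j _ (Nat.mod_lt _ (by norm_num)) h
    · subst h; rfl
  have hsub : Finset.range 5 ⊆ D.image part := by
    have key : ∀ v : RedVertex M K, (∀ u, (graph U M K).Adj u v → u.part = v.part) →
        v.part ∈ D.image part := by
      intro v hv
      rcases hD v with h | ⟨u, hu, hadj⟩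
      · exact Finset.mem_image_of_mem _ h
      · exact hv u hadj ▸ Finset.mem_image_of_mem _ hu
    have h0 := key (assign ⟨0, by omega⟩) (assign_part _)
    have h1 := key (core 9) (core_part 9 (by decide))
    have h2 := key (core 5) (core_part 5 (by decide))
    have h3 := key (core 10) (core_part 10 (by decide))
    have h4 := key (assign ⟨1, by omega⟩) (assign_part _)
    intro i hi
    rw [Finset.mem_range] at hi
    interval_cases i
    exacts [h0, h1, h2, h3, h4]
  simpa using (Finset.card_le_card hsub).trans Finset.card_image_le

/-! ### Acyclic chromatic number -/

/-- The colours of the core vertices. -/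
def coreColor : Fin 11 → Fin 5 := ![2, 3, 4, 3, 2, 0, 1, 2, 3, 0, 0]

/-- A colouring in which the vertices of one colour have at most one neighbour of each higher
colour. -/
def color : RedVertex M K → Fin 5
  | core i => coreColor i
  | clause _ => 2
  | assign _ => 1
  | sub _ _ => 0

theorem color_ne_of_arc {U : ℕ → ℕ → Bool} {u v : RedVertex M K} (h : Arc U u v) :
    color u ≠ color v := by
  rcases u with i | j | x | ⟨c, x⟩ <;> rcases v with i' | j' | x' | ⟨c', x'⟩ <;>
    simp only [Arc] at h <;> simp only [color]
  · revert i i'; decide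
  · subst h; decide
  · have : ∀ i : Fin 11, ∀ b < 2, (i : ℕ) = 4 * b → coreColor i ≠ 1 := by decide
    exact this i _ (Nat.mod_lt _ (by norm_num)) h
  · have : ∀ i : Fin 11, ∀ b < 2, (i : ℕ) = 1 + 2 * b → coreColor i ≠ 0 := by decide
    exact this i _ (Nat.mod_lt _ (by norm_num)) h
  · decide
  · decide

/-- The colouring as a colouring of the graph. -/
def coloring (U : ℕ → ℕ → Bool) (M K : ℕ) : (graph U M K).Coloring (Fin 5) :=
  SimpleGraph.Coloring.mk color fun {_ _} h =>
    h.elim color_ne_of_arc fun h => (color_ne_of_arc h).symm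

/-- A subdivision vertex (colour 0) has exactly three neighbours: an assignment, a clause and a hub,
of colours 1, 2 and 3. Above an assignment there is only its end hub, of colour 2, and above a
clause only the middle hub, of colour 4. Outer vertices adjacent to a hub have lower colour than the
hub, so the rest is a finite check in the core. -/
theorem coloring_unique (U : ℕ → ℕ → Bool) (v u w : RedVertex M K) (hu : (graph U M K).Adj v u)
    (hw : (graph U M K).Adj v w) (hC : color u = color w) (hlt : color v < color u) : u = w := by
  have hcore : ∀ i j : Fin 11, ((i, j) ∈ coreEdges ∨ (j, i) ∈ coreEdges) ∧
      coreColor i < coreColor j → ∀ k, ((i, k) ∈ coreEdges ∨ (k, i) ∈ coreEdges) ∧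
        coreColor j = coreColor k → j = k := by decide
  have hA : ∀ (i : Fin 11) (x : ℕ), (i : ℕ) = 4 * (x % 2) → coreColor i = 2 := by
    have : ∀ i : Fin 11, ∀ b < 2, (i : ℕ) = 4 * b → coreColor i = 2 := by decide
    exact fun i x => this i _ (Nat.mod_lt _ (by norm_num))
  have hS : ∀ (i : Fin 11) (x : ℕ), (i : ℕ) = 1 + 2 * (x % 2) → coreColor i = 3 := by
    have : ∀ i : Fin 11, ∀ b < 2, (i : ℕ) = 1 + 2 * b → coreColor i = 3 := by decide
    exact fun i x => this i _ (Nat.mod_lt _ (by norm_num))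
  have h2 : coreColor 2 = 4 := by decide
  rcases v with i | i | x | ⟨c, x⟩ <;> rcases u with j | j | y | ⟨d, y⟩ <;>
    rcases w with k | k | z | ⟨e, z⟩ <;>
    simp only [adj_iff, Arc, color, or_false, false_or, Fin.not_lt_zero, core.injEq, clause.injEq,
      assign.injEq, reduceCtorEq, Fin.reduceLT, Fin.reduceEq] at hu hw hC hlt ⊢
  case core.core.core => exact hcore i j ⟨hu, hlt⟩ k ⟨hw, hC⟩
  all_goals
    first
      | exact hw.symm
      | exact hu.trans hw.symm
      | exact Fin.ext (hu.trans hw.symm)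
      | (clear hcore hA hS; simp_all; done)
      | (have e₁ := hA _ _ hu; clear hcore hA hS; simp_all; done)
      | (have e₁ := hS _ _ hu; clear hcore hA hS; simp_all; done)
      | (have e₁ := hA _ _ hw; clear hcore hA hS; simp_all; done)
      | (have e₁ := hS _ _ hw; clear hcore hA hS; simp_all; done)
      | (clear hcore hA hS hC hw; simp_all; done)
      | (have e₁ := hA _ _ hu; clear hcore hA hS hC hw; simp_all; done)

/-- A clique on five vertices. -/
def clique (i : Fin 5) : RedVertex M K := core (![2, 5, 6, 7, 8] i)

theorem clique_adj (U : ℕ → ℕ → Bool) (i j : Fin 5) (hij : i ≠ j) :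
    (graph U M K).Adj (clique i) (clique j) := by
  revert i j
  simp only [adj_iff, clique, Arc]
  decide

/-! ### Diameter -/

/-- Zero for the hubs, one for the other vertices. -/
def depth : RedVertex M K → ℕ
  | core i => if (i : ℕ) < 5 then 0 else 1
  | _ => 1

theorem edist_hub_le (U : ℕ → ℕ → Bool) (v : RedVertex M K) :
    (graph U M K).edist (hub ⟨v.layer, v.layer_lt⟩) v ≤ v.depth := by
  by_cases h0 : v.depth = 0
  · rcases v with i | j | x | ⟨c, x⟩ <;> simp only [depth, one_ne_zero] at h0
    have : ∀ i : Fin 11, (if (i : ℕ) < 5 then 0 else 1) = 0 →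
        Fin.castLE (by norm_num) (coreLayer i) = i := by decide
    simp [hub, layer, this i h0]
  · have h1 : v.depth = 1 := by
      rcases v with i | j | x | ⟨c, x⟩ <;> simp only [depth] at h0 ⊢
      split_ifs at h0 ⊢ <;> simp_all
    rw [h1, Nat.cast_one, SimpleGraph.edist_le_one_iff_adj_or_eq]
    exact (eq_or_adj_hub U v).symm.imp_right Eq.symm

theorem edist_hub_hub_le (U : ℕ → ℕ → Bool) (i d : ℕ) (h : i + d < 5) :
    (graph U M K).edist (hub ⟨i, by omega⟩) (hub ⟨i + d, h⟩) ≤ d := by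
  induction d with
  | zero => simp
  | succ d ih =>
    refine SimpleGraph.edist_triangle.trans
      ((add_le_add (ih (by omega)) (SimpleGraph.edist_eq_one_iff_adj.2 ?_).le).trans (by simp))
    refine Or.inl ?_
    have : ∀ j < 4, (Fin.ofNat 11 j, Fin.ofNat 11 (j + 1)) ∈ coreEdges := by decide
    have h' := this (i + d) (by omega)
    have e : ∀ j (hj : j < 5), Fin.ofNat 11 j = Fin.castLE (by norm_num) (⟨j, hj⟩ : Fin 5) := by
      intro j hj
      ext
      simp only [Fin.ofNat_eq_cast, Fin.val_natCast, Fin.val_castLE]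
      omega
    rw [e _ (by omega), e _ (by omega)] at h'
    exact h'

/-- The route goes from `u` to its hub, along the path of hubs, and from the hub of `v` to `v`. -/
theorem edist_le_of_layer_le (U : ℕ → ℕ → Bool) (u v : RedVertex M K) (h : u.layer ≤ v.layer) :
    (graph U M K).edist u v ≤ (u.depth + (v.layer - u.layer) + v.depth : ℕ) := by
  have h1 := edist_hub_le U u
  have h2 := edist_hub_le U v
  have hv := v.layer_lt
  have h3 := edist_hub_hub_le (M := M) (K := K) U u.layer (v.layer - u.layer) (by omega)
  have e : u.layer + (v.layer - u.layer) = v.layer := by omega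
  simp only [e] at h3
  rw [SimpleGraph.edist_comm] at h1
  push_cast
  exact SimpleGraph.edist_triangle.trans
    (add_le_add (SimpleGraph.edist_triangle.trans (add_le_add h1 h3)) h2)

theorem depth_le (v : RedVertex M K) : v.depth ≤ 1 := by
  rcases v with i | j | x | ⟨c, x⟩ <;> simp only [depth] <;> (try split_ifs) <;> omega

theorem ediam_le_six (U : ℕ → ℕ → Bool) : (graph U M K).ediam ≤ 6 := by
  refine SimpleGraph.ediam_le_of_edist_le fun u v => ?_
  wlog h : u.layer ≤ v.layer
  · rw [SimpleGraph.edist_comm]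
    exact this U v u (by omega)
  refine (edist_le_of_layer_le U u v h).trans ?_
  have := u.depth_le
  have := v.depth_le
  have := v.layer_lt
  exact_mod_cast (by omega : u.depth + (v.layer - u.layer) + v.depth ≤ 6)

theorem exists_assign_of_layer_eq_zero {v : RedVertex M K} (h : v.layer = 0) (hd : v.depth ≠ 0) :
    ∃ x : Fin K, (x : ℕ) % 2 = 0 ∧ v = assign x := by
  rcases v with i | j | x | ⟨c, x⟩ <;> simp only [layer, depth] at h hd
  · have : ∀ i : Fin 11, (coreLayer i : ℕ) = 0 → (i : ℕ) < 5 := by decide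
    exact absurd (if_pos (this i h)) hd
  · omega
  · exact ⟨x, by omega, rfl⟩
  · omega

theorem exists_assign_of_layer_eq_four {v : RedVertex M K} (h : v.layer = 4) (hd : v.depth ≠ 0) :
    ∃ x : Fin K, (x : ℕ) % 2 = 1 ∧ v = assign x := by
  rcases v with i | j | x | ⟨c, x⟩ <;> simp only [layer, depth] at h hd
  · have : ∀ i : Fin 11, (coreLayer i : ℕ) = 4 → (i : ℕ) < 5 := by decide
    exact absurd (if_pos (this i h)) hd
  · omega
  · exact ⟨x, by omega, rfl⟩
  · omega

theorem edist_assign_le {U : ℕ → ℕ → Bool} {c : Fin M} {x : Fin K} (h : U c x = true) :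
    (graph U M K).edist (assign x) (clause ⟨c, by omega⟩) ≤ 2 := by
  have h1 : (graph U M K).Adj (assign x) (sub c x) := Or.inl rfl
  have h2 : (graph U M K).Adj (sub c x) (clause ⟨c, by omega⟩) := Or.inr (by simp [Arc, target, h])
  refine (SimpleGraph.Walk.edist_le (.cons h1 (.cons h2 .nil))).trans ?_
  simp

theorem ediam_le_five {U : ℕ → ℕ → Bool}
    (h : ∀ x y : Fin K, (x : ℕ) % 2 = 0 → (y : ℕ) % 2 = 1 → ∃ c : Fin M, U c x ∧ U c y) :
    (graph U M K).ediam ≤ 5 := by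
  refine SimpleGraph.ediam_le_of_edist_le fun u v => ?_
  wlog hl : u.layer ≤ v.layer
  · rw [SimpleGraph.edist_comm]
    exact this h v u (by omega)
  have hu := u.depth_le
  have hv := v.depth_le
  have := v.layer_lt
  by_cases h5 : u.depth + (v.layer - u.layer) + v.depth ≤ 5
  · exact (edist_le_of_layer_le U u v hl).trans (by exact_mod_cast h5)
  -- The hub route has length six only between the extreme layers 0 and 4 with both ends off the
  -- hubs, that is, between assignments of opposite halves. A common unsatisfied clause then gives a
  -- route of length four.
  · obtain ⟨x, hx, rfl⟩ := exists_assign_of_layer_eq_zero (v := u) (by omega) (by omega)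
    obtain ⟨y, hy, rfl⟩ := exists_assign_of_layer_eq_four (v := v) (by omega) (by omega)
    obtain ⟨c, hcx, hcy⟩ := h x y hx hy
    have h1 := edist_assign_le hcx
    have h2 := edist_assign_le hcy
    rw [SimpleGraph.edist_comm] at h2
    exact SimpleGraph.edist_triangle.trans ((add_le_add h1 h2).trans (by norm_num))

/-- If `x` and `y` have no common unsatisfied clause, this is a potential which changes by at most
one along edges and differs by six between `x` and `y`. -/
def potential (U : ℕ → ℕ → Bool) (x y : ℕ) : RedVertex M K → ℕ
  | core i => ![1, 2, 3, 4, 5, 4, 4, 4, 4, 3, 5] i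
  | clause j => if (j : ℕ) = M ∨ (j : ℕ) < M ∧ U j x then 2 else 4
  | assign z => if (z : ℕ) = x then 0 else if (z : ℕ) = y then 6 else if (z : ℕ) % 2 = 0 then 2 else 4
  | sub _ z => if (z : ℕ) = x then 1 else if (z : ℕ) = y then 5 else 3

/-- The critical edges join subdivision vertices to clauses: the clauses next to `x` need the value
2, those next to `y` the value 4, and these requirements are compatible because no clause is
unsatisfied by both. The dummy clauses `M` and `M + 1` receive 2 and 4 since they serve different
halves. -/
theorem potential_arc {U : ℕ → ℕ → Bool} {x y : ℕ} (hx : x % 2 = 0) (hy : y % 2 = 1)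
    (h : ∀ c < M, ¬ (U c x ∧ U c y)) {u v : RedVertex M K} (huv : Arc U u v) :
    u.potential U x y ≤ v.potential U x y + 1 ∧ v.potential U x y ≤ u.potential U x y + 1 := by
  rcases u with i | j | z | ⟨c, z⟩ <;> rcases v with i' | j' | z' | ⟨c', z'⟩ <;>
    simp only [Arc] at huv <;> simp only [potential]
  · revert i i'; decide
  · subst huv
    simp only [Fin.isValue, Matrix.cons_val]
    split_ifs <;> omega
  · have : ∀ i : Fin 11, ∀ b < 2, (i : ℕ) = 4 * b →
        (![1, 2, 3, 4, 5, 4, 4, 4, 4, 3, 5] i : ℕ) = 4 * b + 1 := by decide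
    rw [this i _ (Nat.mod_lt _ (by norm_num)) huv]
    split_ifs <;> omega
  · have : ∀ i : Fin 11, ∀ b < 2, (i : ℕ) = 1 + 2 * b →
        (![1, 2, 3, 4, 5, 4, 4, 4, 4, 3, 5] i : ℕ) = 2 * b + 2 := by decide
    rw [this i _ (Nat.mod_lt _ (by norm_num)) huv]
    split_ifs <;> omega
  · rw [huv, target]
    have hc := h c' c'.2
    have hc' := c'.2
    by_cases hU : U c' z'
    · simp only [hU, if_true]
      by_cases hzx : (z' : ℕ) = x
      · have : U c' x := hzx ▸ hU
        simp [hzx, this]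
      · by_cases hzy : (z' : ℕ) = y
        · have h1 : U c' y := hzy ▸ hU
          -- This is where the absence of a common unsatisfied clause enters: the clause next to `y`
          -- has potential 4.
          have h2 : ¬ U c' x := fun h2 => hc ⟨h2, h1⟩
          have h3 : y ≠ x := by omega
          have h4 : (c' : ℕ) ≠ M := by omega
          simp [hzy, h2, h3, h4]
        · simp only [hzx, hzy, if_false]
          split_ifs <;> omega
    · simp only [hU]
      split_ifs <;> simp_all
  · subst huv
    split_ifs <;> omega

theorem six_le_ediam {U : ℕ → ℕ → Bool} {x y : Fin K} (hx : (x : ℕ) % 2 = 0)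
    (hy : (y : ℕ) % 2 = 1) (h : ∀ c < M, ¬ (U c x ∧ U c y)) : 6 ≤ (graph U M K).ediam := by
  refine le_trans ?_ (SimpleGraph.edist_le_ediam (u := assign x) (v := assign y))
  have := SimpleGraph.le_edist_of_potential (G := graph U M K) (potential U x y)
    (fun u v huv => huv.elim (fun e => (potential_arc hx hy h e).2)
      fun e => (potential_arc hx hy h e).1) (assign x) (assign y)
  have hne : (y : ℕ) ≠ x := by omega
  simpa [potential, hne] using this

theorem connected_graph (U : ℕ → ℕ → Bool) (M K : ℕ) : (graph U M K).Connected := by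
  have : Nonempty (RedVertex M K) := ⟨core 0⟩
  refine SimpleGraph.connected_of_ediam_ne_top fun h => ?_
  have := ediam_le_six (M := M) (K := K) U
  rw [h] at this
  exact absurd this (by decide)

theorem diam_graph_eq_six_iff (U : ℕ → ℕ → Bool) : (graph U M K).diam = 6 ↔
    ∃ x y : Fin K, (x : ℕ) % 2 = 0 ∧ (y : ℕ) % 2 = 1 ∧ ∀ c < M, ¬ (U c x ∧ U c y) := by
  constructor
  · intro hd
    by_contra! hcon
    have h5 : (graph U M K).ediam ≤ 5 := ediam_le_five fun x y hx hy => by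
      obtain ⟨c, hc, h⟩ := hcon x y hx hy
      exact ⟨⟨c, hc⟩, h⟩
    have := ENat.toNat_le_toNat h5 (by decide)
    unfold SimpleGraph.diam at hd
    rw [hd] at this
    exact absurd this (by decide)
  · rintro ⟨x, y, hx, hy, h⟩
    unfold SimpleGraph.diam
    rw [le_antisymm (ediam_le_six U) (six_le_ediam hx hy h)]
    rfl

theorem diam_graph_le_six (U : ℕ → ℕ → Bool) : (graph U M K).diam ≤ 6 :=
  ENat.toNat_le_toNat (ediam_le_six U) (by decide)

end RedVertex

namespace RedVertex

variable {M K : ℕ}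

/-! ### Numbering and list of edges -/

/-- The number of vertices. -/
def count (M K : ℕ) : ℕ := 13 + M + K + M * K

/-- The number of a vertex. -/
def num : RedVertex M K → ℕ
  | core i => i
  | clause j => 11 + j
  | assign x => 13 + M + x
  | sub c x => 13 + M + K + c * K + x

theorem mul_add_lt {c x : ℕ} (hc : c < M) (hx : x < K) : c * K + x < M * K := by
  have : (c + 1) * K ≤ M * K := Nat.mul_le_mul_right K hc
  linarith [add_mul c 1 K]

theorem num_lt (v : RedVertex M K) : v.num < count M K := by
  rcases v with i | j | x | ⟨c, x⟩ <;> simp only [num, count]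
  · omega
  · omega
  · omega
  · have := mul_add_lt c.2 x.2
    omega

theorem num_injective : Function.Injective (num : RedVertex M K → ℕ) := by
  rintro (i | j | x | ⟨c, x⟩) (i' | j' | x' | ⟨c', x'⟩) h <;> simp only [num] at h
  case core.core => exact congrArg core (Fin.ext h)
  case clause.clause => exact congrArg clause (Fin.ext (by omega))
  case assign.assign => exact congrArg assign (Fin.ext (by omega))
  case sub.sub =>
    have h' : (c : ℕ) * K + x = c' * K + x' := by omega
    have hx : (x : ℕ) = x' := by
      have := congrArg (· % K) h'
      simpa [Nat.mul_add_mod_self_right, Nat.mod_eq_of_lt] using this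
    have hc : (c : ℕ) = c' := by
      rw [hx] at h'
      exact Nat.eq_of_mul_eq_mul_right (by omega) (by omega : (c : ℕ) * K = c' * K)
    rw [Fin.ext hx, Fin.ext hc]
  all_goals (exfalso; omega)

theorem exists_num_eq {k : ℕ} (hk : k < count M K) : ∃ v : RedVertex M K, v.num = k := by
  unfold count at hk
  by_cases h1 : k < 11
  · exact ⟨core ⟨k, h1⟩, rfl⟩
  by_cases h2 : k < 13 + M
  · exact ⟨clause ⟨k - 11, by omega⟩, by simp only [num]; omega⟩
  by_cases h3 : k < 13 + M + K
  · exact ⟨assign ⟨k - (13 + M), by omega⟩, by simp only [num]; omega⟩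
  have hK : 0 < K := by
    rcases Nat.eq_zero_or_pos K with rfl | h
    · simp at hk; omega
    · exact h
  refine ⟨sub ⟨(k - (13 + M + K)) / K, ?_⟩ ⟨(k - (13 + M + K)) % K, Nat.mod_lt _ hK⟩, ?_⟩
  · rw [Nat.div_lt_iff_lt_mul hK]
    omega
  · simp only [num]
    have := Nat.div_add_mod' (k - (13 + M + K)) K
    omega

/-- The numbering of the vertices. -/
noncomputable def numEquiv (M K : ℕ) : RedVertex M K ≃ Fin (count M K) :=
  Equiv.ofBijective (fun v => ⟨v.num, v.num_lt⟩)
    ⟨fun _ _ h => num_injective (Fin.ext_iff.1 h), fun k =>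
      let ⟨v, hv⟩ := exists_num_eq k.2
      ⟨v, Fin.ext hv⟩⟩

theorem numEquiv_val (v : RedVertex M K) : (numEquiv M K v : ℕ) = v.num := rfl

theorem target_lt {U : ℕ → ℕ → Bool} {c : ℕ} (hc : c < M) (x : ℕ) : target U M c x < M + 2 := by
  unfold target
  split_ifs <;> omega

/-- The list of the edges. -/
def edgeList (U : ℕ → ℕ → Bool) (M K : ℕ) : List (RedVertex M K × RedVertex M K) :=
  coreEdges.map (fun e => (core e.1, core e.2)) ++
    ((List.finRange (M + 2)).map (fun j => (core 2, clause j)) ++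
      ((List.finRange K).map (fun x : Fin K => (core ⟨4 * (x % 2), by omega⟩, assign x)) ++
        (List.finRange M).flatMap fun c : Fin M => (List.finRange K).flatMap fun x : Fin K =>
          [(core ⟨1 + 2 * (x % 2), by omega⟩, sub c x), (assign x, sub c x),
            (clause ⟨target U M c x, target_lt c.2 x⟩, sub c x)]))

theorem mem_edgeList {U : ℕ → ℕ → Bool} {u v : RedVertex M K} :
    (u, v) ∈ edgeList U M K ↔ Arc U u v := by
  rcases u with i | j | x | ⟨c, x⟩ <;> rcases v with i' | j' | x' | ⟨c', x'⟩ <;>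
    simp [edgeList, Arc, Fin.ext_iff]
  case core.core =>
    constructor
    · rintro ⟨a, b, h, ha, hb⟩
      rwa [← Fin.ext ha, ← Fin.ext hb]
    · exact fun h => ⟨_, _, h, rfl, rfl⟩
  all_goals grind

theorem nodup_edgeList (U : ℕ → ℕ → Bool) (M K : ℕ) : (edgeList U M K).Nodup := by
  have hd : ∀ {c c' : Fin M}, c ≠ c' → ∀ (x x' : Fin K) (a : RedVertex M K × RedVertex M K),
      a.2 = sub c x → a.2 ≠ sub c' x' := by
    rintro c c' hc x x' a h1 h2
    rw [h1, sub.injEq] at h2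
    exact hc h2.1
  simp only [edgeList, List.nodup_append', List.nodup_flatMap]
  refine ⟨(by decide : coreEdges.Nodup).map ?_, ⟨(List.nodup_finRange _).map ?_,
    ⟨(List.nodup_finRange _).map ?_, ⟨fun c _ => ⟨fun x _ => ?_, ?_⟩, ?_⟩, ?_⟩, ?_⟩, ?_⟩
  · rintro ⟨a, b⟩ ⟨a', b'⟩ h
    simpa using h
  · rintro j j' h
    simpa using h
  · rintro x x' h
    simp only [Prod.mk.injEq, assign.injEq] at h
    exact h.2
  · simp
  · refine (List.nodup_finRange K).imp fun {x x'} hx a h1 h2 => ?_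
    simp only [List.mem_cons, List.not_mem_nil, or_false] at h1 h2
    rcases h1 with rfl | rfl | rfl <;> simp_all
  · refine (List.nodup_finRange M).imp fun {c c'} hc a h1 h2 => ?_
    simp only [List.mem_flatMap, List.mem_cons, List.not_mem_nil, or_false] at h1 h2
    obtain ⟨x, -, h1⟩ := h1
    obtain ⟨x', -, h2⟩ := h2
    exact hd hc x x' a (by rcases h1 with rfl | rfl | rfl <;> rfl)
      (by rcases h2 with rfl | rfl | rfl <;> rfl)
  all_goals
    intro a h1 h2
    simp only [List.mem_append, List.mem_map, List.mem_flatMap, List.mem_cons, List.not_mem_nil,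
      or_false] at h1 h2
    obtain ⟨b, -, rfl⟩ := h1
    simp at h2

/-- This excludes that an edge is listed in both orientations, as needed for the unordered edges to
be distinct. -/
theorem num_lt_of_arc {U : ℕ → ℕ → Bool} {u v : RedVertex M K} (h : Arc U u v) :
    u.num < v.num := by
  rcases u with i | j | x | ⟨c, x⟩ <;> rcases v with i' | j' | x' | ⟨c', x'⟩ <;>
    simp only [Arc] at h <;> simp only [num]
  · revert i i'; decide
  all_goals omega

/-- The graph of the formula, on the numbers of the vertices. -/
noncomputable def numGraph (U : ℕ → ℕ → Bool) (M K : ℕ) : SimpleGraph (Fin (count M K)) :=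
  (graph U M K).comap (numEquiv M K).symm

/-- The numbering is an isomorphism. -/
noncomputable def numIso (U : ℕ → ℕ → Bool) (M K : ℕ) : numGraph U M K ≃g graph U M K :=
  SimpleGraph.Iso.comap (numEquiv M K).symm (graph U M K)

/-- The list of the edges, on the numbers of the vertices. -/
noncomputable def numEdgeList (U : ℕ → ℕ → Bool) (M K : ℕ) :
    List (Fin (count M K) × Fin (count M K)) :=
  (edgeList U M K).map fun e => (numEquiv M K e.1, numEquiv M K e.2)

theorem isEdgeList_numEdgeList (U : ℕ → ℕ → Bool) (M K : ℕ) :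
    IsEdgeList (numGraph U M K) (numEdgeList U M K) := by
  constructor
  · rw [numEdgeList, List.map_map]
    refine (nodup_edgeList U M K).map_on ?_
    rintro ⟨u, v⟩ huv ⟨u', v'⟩ huv' h
    have h1 := num_lt_of_arc (mem_edgeList.1 huv)
    have h2 := num_lt_of_arc (mem_edgeList.1 huv')
    simp only [Function.comp, Sym2.eq_iff, EmbeddingLike.apply_eq_iff_eq] at h
    rcases h with ⟨rfl, rfl⟩ | ⟨rfl, rfl⟩
    · rfl
    · omega
  · intro u v
    obtain ⟨u, rfl⟩ := (numEquiv M K).surjective u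
    obtain ⟨v, rfl⟩ := (numEquiv M K).surjective v
    simp only [numEdgeList, List.map_map, List.mem_map, Function.comp, Prod.exists, Sym2.eq_iff,
      EmbeddingLike.apply_eq_iff_eq, numGraph, SimpleGraph.comap_adj, Equiv.symm_apply_apply,
      adj_iff, mem_edgeList]
    constructor
    · rintro ⟨a, b, h, ⟨rfl, rfl⟩ | ⟨rfl, rfl⟩⟩
      exacts [Or.inl h, Or.inr h]
    · rintro (h | h)
      exacts [⟨u, v, h, Or.inl ⟨rfl, rfl⟩⟩, ⟨v, u, h, Or.inr ⟨rfl, rfl⟩⟩]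

theorem connected_numGraph (U : ℕ → ℕ → Bool) (M K : ℕ) : (numGraph U M K).Connected :=
  (numIso U M K).connected_iff.2 (connected_graph U M K)

theorem acyclicChromaticNumber_numGraph (U : ℕ → ℕ → Bool) (M K : ℕ) :
    acyclicChromaticNumber (numGraph U M K) = 5 :=
  acyclicChromaticNumber_eq_of_iso (numIso U M K) (coloring U M K) (coloring_unique U) clique
    (clique_adj U)

theorem dominationNumber_numGraph (U : ℕ → ℕ → Bool) (M : ℕ) (hK : 2 ≤ K) :
    dominationNumber (numGraph U M K) = 5 :=
  (dominationNumber_eq_of_iso (numIso U M K)).trans (dominationNumber_graph U hK)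

/-! ### The input for Diameter -/

/-- The number of edges. -/
def edgeCount (M K : ℕ) : ℕ := 18 + M + K + 3 * (M * K)

/-- The numbers of the edges at `sub c x`. -/
def subBlock (U : ℕ → ℕ → Bool) (M K c x : ℕ) : List ℕ :=
  [1 + 2 * (x % 2), 13 + M + K + c * K + x, 13 + M + x, 13 + M + K + c * K + x,
    11 + target U M c x, 13 + M + K + c * K + x]

/-- The initial part of the input for Diameter. -/
def headBlock (M K : ℕ) : List ℕ :=
  [count M K, edgeCount M K, 5, 5] ++ coreEdges.flatMap fun e => [(e.1 : ℕ), (e.2 : ℕ)]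

/-- The input for Diameter. -/
def input (U : ℕ → ℕ → Bool) (M K : ℕ) : List ℕ :=
  headBlock M K ++ (List.range (M + 2)).flatMap (fun j => [2, 11 + j]) ++
    (List.range K).flatMap (fun x => [4 * (x % 2), 13 + M + x]) ++
    (List.range M).flatMap fun c => (List.range K).flatMap fun x => subBlock U M K c x

theorem flatMap_finRange {α : Type*} (n : ℕ) (g : ℕ → List α) :
    (List.finRange n).flatMap (fun i : Fin n => g i) = (List.range n).flatMap g := by
  rw [← List.map_coe_finRange_eq_range, List.flatMap_map]

/-- Thanks to the dummy clauses every subdivision vertex has exactly three edges. The number of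
edges is therefore independent of `U` and can be written before any clause is inspected. -/
theorem length_numEdgeList (U : ℕ → ℕ → Bool) (M K : ℕ) :
    (numEdgeList U M K).length = edgeCount M K := by
  simp [numEdgeList, edgeList, edgeCount, List.length_flatMap, coreEdges]
  ring

theorem encode_numGraph (U : ℕ → ℕ → Bool) (M : ℕ) (hK : 2 ≤ K) :
    encodeDiameterInstance (count M K) (numEdgeList U M K)
      (acyclicChromaticNumber (numGraph U M K)) (dominationNumber (numGraph U M K)) =
        input U M K := by
  have h1 := flatMap_finRange (M + 2) (fun j => [2, 11 + j])
  have h2 := flatMap_finRange K (fun x => [4 * (x % 2), 13 + M + x])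
  have h3 := flatMap_finRange M fun c => (List.range K).flatMap fun x => subBlock U M K c x
  have h4 : ∀ c, _ := fun c => flatMap_finRange K fun x => subBlock U M K c x
  unfold encodeDiameterInstance input headBlock
  rw [acyclicChromaticNumber_numGraph, dominationNumber_numGraph U M hK, length_numEdgeList,
    ← h1, ← h2, ← h3]
  simp only [← h4]
  simp only [numEdgeList, edgeList, List.flatMap_append, List.map_append, List.flatMap_map,
    List.map_map, List.map_flatMap, List.flatMap_assoc, numEquiv_val, num, List.append_assoc,
    List.cons_append, List.nil_append, List.map_cons, List.map_nil, List.flatMap_cons,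
    List.flatMap_nil, subBlock]
  rfl

end RedVertex

/-! ## The program for the reduction -/

/-- The contents of a register with a fixed address. -/
abbrev RamExpr.reg (i : ℕ) : RamExpr := .read (.lit i)

/-- The parameters of the reduction: the input, the number of clauses, the number of variables in
one half, the number of assignments, and the address to which the first registers are saved. -/
structure RedData where
  inp : List ℕ
  M : ℕ
  h : ℕ
  K : ℕ
  F : ℕ

namespace RedData

variable (D : RedData)

/-- The memory during the reduction. -/
def mem (x c p : ℕ) (out : List ℕ) : RamMem
  | 0 => x
  | 1 => D.M
  | 2 => D.h
  | 3 => D.K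
  | 4 => out.length
  | 5 => D.F + 8
  | 6 => c
  | 7 => p
  | a + 8 =>
    if a + 8 < D.F then D.inp.getD (a + 8) 0
    else if a + 8 < D.F + 8 then D.inp.getD (a + 8 - D.F) 0
    else out.getD (a + 8 - (D.F + 8)) 0

/-- All numbers are shorter than `W` bits, also those of the output `full`. -/
structure Bounded (W : ℕ) (full : List ℕ) : Prop where
  inp_lt : ∀ v ∈ D.inp, v < 2 ^ W
  M_lt : D.M + 2 < 2 ^ W
  h_lt : D.h < 2 ^ W
  K_lt : D.K < 2 ^ W
  F_lt : D.F + 8 < 2 ^ W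
  W_pos : 1 ≤ W
  full_lt : ∀ v ∈ full, v < 2 ^ W
  length_lt : full.length < 2 ^ W

variable {D} {W : ℕ} {full : List ℕ}

theorem getD_lt {l : List ℕ} (h : ∀ v ∈ l, v < 2 ^ W) (i : ℕ) : l.getD i 0 < 2 ^ W := by
  by_cases hi : i < l.length
  · rw [List.getD_eq_getElem _ _ hi]
    exact h _ (List.getElem_mem hi)
  · rw [List.getD_eq_default _ _ (by omega)]
    positivity

/-- Every intermediate output is a prefix of `full`, so a single `W` serves for the whole run. -/
theorem Bounded.mem_lt (hD : D.Bounded W full) {x c p : ℕ} {out : List ℕ} (hx : x < 2 ^ W)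
    (hc : c < 2 ^ W) (hp : p < 2 ^ W) (hout : out <+: full) (a : ℕ) :
    D.mem x c p out a < 2 ^ W := by
  have h1 := hD.M_lt
  match a with
  | 0 => exact hx
  | 1 => exact (by omega : D.M < 2 ^ W)
  | 2 => exact hD.h_lt
  | 3 => exact hD.K_lt
  | 4 => exact hout.length_le.trans_lt hD.length_lt
  | 5 => exact hD.F_lt
  | 6 => exact hc
  | 7 => exact hp
  | a + 8 =>
    simp only [mem]
    split_ifs
    · exact getD_lt hD.inp_lt _
    · exact getD_lt hD.inp_lt _
    · exact getD_lt (fun v hv => hD.full_lt v (hout.subset hv)) _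

/-! ### Writing the output -/

/-- Append the value of an expression to the output. -/
def push (e : RamExpr) : RamProg :=
  .seq (.store (.op .add (.reg 5) (.reg 4)) e) (.store (.lit 4) (.op .add (.reg 4) (.lit 1)))

/-- Append the values of several expressions to the output. -/
def pushAll : List RamExpr → RamProg
  | [] => .skip
  | e :: es => .seq (push e) (pushAll es)

/-- A bound for the cost of `pushAll`. -/
def pushAllWeight : List RamExpr → ℕ
  | [] => 1
  | e :: es => e.weight + 40 + pushAllWeight es

/-- The cells behind the output hold the default value 0, so appending affects just one of them and
the length counter. -/
theorem mem_push (x c p v : ℕ) (out : List ℕ) :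
    D.mem x c p (out ++ [v]) =
      Function.update (Function.update (D.mem x c p out) (D.F + 8 + out.length) v) 4
        (out.length + 1) := by
  funext a
  match a with
  | 0 | 1 | 2 | 3 | 5 | 6 | 7 =>
    rw [Function.update_of_ne (by norm_num), Function.update_of_ne (by omega)]
    rfl
  | 4 => simp [mem]
  | a + 8 =>
    rw [Function.update_of_ne (by omega)]
    by_cases h : a + 8 = D.F + 8 + out.length
    · have h' : a = D.F + out.length := by omega
      subst h'
      rw [h, Function.update_self, ← h]
      simp only [mem]
      rw [if_neg (by omega), if_neg (by omega), List.getD_append_right _ _ _ _ (by omega)]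
      have : D.F + out.length + 8 - (D.F + 8) - out.length = 0 := by omega
      rw [this]; rfl
    · rw [Function.update_of_ne h]
      simp only [mem]
      split_ifs with h1 h2
      · rfl
      · rfl
      · by_cases h3 : a + 8 < D.F + 8 + out.length
        · rw [List.getD_append _ _ _ _ (by omega)]
        · rw [List.getD_eq_default _ _ (by simp; omega), List.getD_eq_default _ _ (by omega)]

theorem runs_push (hD : D.Bounded W full) {x c p v : ℕ} {out : List ℕ} (hx : x < 2 ^ W)
    (hc : c < 2 ^ W) (hp : p < 2 ^ W) (hout : out ++ [v] <+: full) {e : RamExpr} (he : e.NoShl)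
    (hv : e.eval (D.mem x c p out) = v) :
    (push e).Runs (D.mem x c p out) (D.mem x c p (out ++ [v])) ((e.weight + 39) * W) := by
  have hout' : out <+: full := (List.prefix_append out [v]).trans hout
  have hb := hD.mem_lt hx hc hp hout'
  have hv' : v < 2 ^ W := hD.full_lt v (hout.subset (by simp))
  have h1 := RamProg.runs_store_of_noShl (a := .op .add (.reg 5) (.reg 4)) (e := e) hD.W_pos hb
    (by simp [RamExpr.NoShl]) he rfl
  have h2 := RamProg.runs_store_of_noShl (a := .lit 4) (e := .op .add (.reg 4) (.lit 1)) hD.W_pos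
    (s := Function.update (D.mem x c p out)
      ((RamExpr.op .add (.reg 5) (.reg 4)).eval (D.mem x c p out)) (e.eval (D.mem x c p out)))
    (s' := D.mem x c p (out ++ [v])) ?_ (by simp [RamExpr.NoShl]) (by simp [RamExpr.NoShl]) ?_
  · refine (h1.seq h2).mono ?_
    have := hD.W_pos
    have e1 : (RamExpr.op .add (.reg 5) (.reg 4)).weight = 16 := by decide
    have e2 : (RamExpr.lit 4).weight = 4 := by decide
    have e3 : (RamExpr.op .add (.reg 4) (.lit 1)).weight = 13 := by decide
    rw [e1, e2, e3]
    nlinarith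
  · intro a
    rw [Function.update_apply]
    split_ifs
    · rw [hv]; exact hv'
    · exact hb a
  · rw [mem_push, hv]
    have e1 : (RamExpr.op .add (.reg 5) (.reg 4)).eval (D.mem x c p out) = D.F + 8 + out.length := rfl
    rw [e1]
    have e2 : (RamExpr.op .add (.reg 4) (.lit 1)).eval
        (Function.update (D.mem x c p out) (D.F + 8 + out.length) v) = out.length + 1 := by
      simp only [RamExpr.eval, RamOp.eval]
      rw [Function.update_of_ne (by omega)]
      rfl
    rw [e2]
    rfl

theorem runs_pushAll (hD : D.Bounded W full) {x c p : ℕ} (hx : x < 2 ^ W) (hc : c < 2 ^ W)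
    (hp : p < 2 ^ W) {es : List RamExpr} {vs : List ℕ}
    (h : List.Forall₂ (fun e v => e.NoShl ∧ ∀ out, e.eval (D.mem x c p out) = v) es vs)
    {out : List ℕ} (hout : out ++ vs <+: full) :
    (pushAll es).Runs (D.mem x c p out) (D.mem x c p (out ++ vs)) (pushAllWeight es * W) := by
  have hW := hD.W_pos
  induction h generalizing out with
  | nil => exact ⟨1, by simpa [pushAllWeight] using hW, by simpa [pushAll] using RamExec.skip _⟩
  | @cons e v es vs hev _ ih =>
    have hout' : (out ++ [v]) ++ vs <+: full := by simpa using hout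
    have h1 := runs_push hD hx hc hp ((List.prefix_append _ _).trans hout') hev.1 (hev.2 out)
    have h2 := (h1.seq (ih hout')).mono (d := pushAllWeight (e :: es) * W)
      (by simp only [pushAllWeight]; nlinarith)
    simpa [pushAll] using h2

/-! ### Loops -/

/-- Run the body for all values of register `0` below the value of `T`. -/
def forX (T : RamExpr) (body : RamProg) : RamProg :=
  .seq (.store (.lit 0) (.lit 0))
    (.loop (.op .lt (.reg 0) T) (.seq body (.store (.lit 0) (.op .add (.reg 0) (.lit 1)))))

theorem mem_update_zero (x y c p : ℕ) (out : List ℕ) :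
    D.mem y c p out = Function.update (D.mem x c p out) 0 y := by
  funext a
  match a with
  | 0 => simp [mem]
  | 1 | 2 | 3 | 4 | 5 | 6 | 7 | a + 8 =>
    rw [Function.update_of_ne (by omega)]
    rfl

theorem prefix_flatMap_range {g : ℕ → List ℕ} {i j : ℕ} (h : i ≤ j) :
    (List.range i).flatMap g <+: (List.range j).flatMap g := by
  obtain ⟨d, rfl⟩ := Nat.exists_eq_add_of_le h
  rw [List.range_add, List.flatMap_append]
  exact List.prefix_append _ _

theorem flatMap_range_succ (g : ℕ → List ℕ) (i : ℕ) :
    (List.range (i + 1)).flatMap g = (List.range i).flatMap g ++ g i := by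
  simp [List.range_succ, List.flatMap_append]

/-- Invariant: before round `j` register 0 holds `j`, and the lists `g 0`, ..., `g (j - 1)` have
been appended. The bound `T` must not depend on what the loop changes. -/
theorem runs_forX (hD : D.Bounded W full) {x₀ c p n β : ℕ} (hx : x₀ < 2 ^ W) (hc : c < 2 ^ W)
    (hp : p < 2 ^ W) (hn : n < 2 ^ W) {T : RamExpr} (hT : T.NoShl)
    (hTn : ∀ x out, T.eval (D.mem x c p out) = n) {body : RamProg} {g : ℕ → List ℕ}
    (hbody : ∀ x < n, ∀ out, out ++ g x <+: full →
      body.Runs (D.mem x c p out) (D.mem x c p (out ++ g x)) (β * W))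
    {out : List ℕ} (hout : out ++ (List.range n).flatMap g <+: full) :
    (forX T body).Runs (D.mem x₀ c p out) (D.mem n c p (out ++ (List.range n).flatMap g))
      ((n + 1) * ((β + 2 * (RamExpr.op .lt (.reg 0) T).weight + 40) * W)) := by
  have hW := hD.W_pos
  have hpre : ∀ j ≤ n, out ++ (List.range j).flatMap g <+: full := fun j hj =>
    ((List.prefix_append_right_inj out).2 (prefix_flatMap_range hj)).trans hout
  have hb0 := hD.mem_lt hx hc hp ((List.prefix_append _ _).trans hout)
  have h0 := RamProg.runs_store_of_noShl (a := .lit 0) (e := .lit 0) hW hb0 trivial trivial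
    (mem_update_zero x₀ 0 c p out)
  have hloop := RamProg.runs_loop (e := .op .lt (.reg 0) T)
    (P := .seq body (.store (.lit 0) (.op .add (.reg 0) (.lit 1)))) (T := n)
    (b := (RamExpr.op .lt (.reg 0) T).weight * W) (c := 1 + β * W + 15 * W)
    (fun j => D.mem j c p (out ++ (List.range j).flatMap g)) ?_ ?_ ?_ ?_
  · simp only [List.range_zero, List.flatMap_nil, List.append_nil] at hloop
    refine (h0.seq hloop).mono ?_
    have e1 : (RamExpr.lit 0).weight = 1 := by decide
    rw [e1]
    generalize (RamExpr.op .lt (.reg 0) T).weight = w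
    nlinarith [Nat.zero_le (n * W), Nat.zero_le (n * (W * w)), Nat.zero_le (n * (W * β)),
      Nat.zero_le (W * w), Nat.zero_le (W * β), Nat.mul_le_mul_left n hW]
  · intro j hj
    exact RamExpr.cost_le hW (hD.mem_lt (by omega) hc hp (hpre j hj))
      (by simp [RamExpr.NoShl, hT])
  · intro j hj
    simp only [RamExpr.eval, RamOp.eval, hTn]
    rw [if_pos (by exact hj)]
    exact one_ne_zero
  · simp only [RamExpr.eval, RamOp.eval, hTn]
    rw [if_neg (by exact lt_irrefl n)]
  · intro j hj
    have hpj := hpre (j + 1) hj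
    rw [flatMap_range_succ, ← List.append_assoc] at hpj
    have h1 := hbody j hj _ hpj
    have h2 := RamProg.runs_store_of_noShl (a := .lit 0) (e := .op .add (.reg 0) (.lit 1)) hW
      (hD.mem_lt (x := j) (by omega) hc hp hpj) trivial (by simp [RamExpr.NoShl])
      (mem_update_zero j (j + 1) c p _)
    rw [flatMap_range_succ, ← List.append_assoc]
    exact (h1.seq h2).mono (by
      have e1 : (RamExpr.lit 0).weight = 1 := by decide
      have e2 : (RamExpr.op .add (.reg 0) (.lit 1)).weight = 10 := by decide
      rw [e1, e2]; omega)

end RedData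

/-! ## Partial assignments and the positions of the clauses -/

namespace CnfFormula

variable {n : ℕ}

/-- The number which encodes a literal. -/
def code (l : Fin n × Bool) : ℕ := 2 * (l.1 : ℕ) + (if l.2 then 1 else 0)

/-- The literal with code `l` is true under the assignment `x`. The parity of `x` tells which half
of the variables is assigned, and `x / 2` lists the truth values. -/
def litTrue (h x l : ℕ) : Bool := decide (l / 2 / h = x % 2 ∧ ((x / 2) >>> (l / 2 % h)) % 2 = l % 2)

/-- The assignment `x` satisfies no literal of clause `c`. -/
def falsified (φ : CnfFormula n) (h c x : ℕ) : Bool :=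
  (φ.getD c []).all fun l => !litTrue h x (code l)

theorem litTrue_code {h x : ℕ} {l : Fin n × Bool} :
    litTrue h x (code l) = true ↔ (l.1 : ℕ) / h = x % 2 ∧ (x / 2).testBit (l.1 % h) = l.2 := by
  have h1 : code l / 2 = l.1 := by unfold code; split_ifs <;> omega
  have h2 : code l % 2 = if l.2 then 1 else 0 := by unfold code; split_ifs <;> omega
  rw [litTrue, decide_eq_true_iff, h1, h2, Nat.shiftRight_eq_div_pow,
    Nat.testBit_eq_decide_div_mod_eq]
  refine and_congr_right fun _ => ?_
  have := Nat.mod_two_eq_zero_or_one (x / 2 / 2 ^ ((l.1 : ℕ) % h))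
  cases l.2 <;> simp

/-- Variable v belongs to half v / h and is bit v % h there. Two partial assignments of different
parity combine to a full one, which satisfies a clause iff one of the two parts does. -/
theorem satisfiable_iff (φ : CnfFormula n) {h : ℕ} (hn : n ≤ 2 * h) :
    φ.Satisfiable ↔ ∃ x y : Fin (2 * 2 ^ h), (x : ℕ) % 2 = 0 ∧ (y : ℕ) % 2 = 1 ∧
      ∀ c < φ.length, ¬ (φ.falsified h c x ∧ φ.falsified h c y) := by
  have hdiv : ∀ v : Fin n, (v : ℕ) / h = 0 ∨ (v : ℕ) / h = 1 := by
    intro v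
    have := v.2
    have : (v : ℕ) / h < 2 := by rw [Nat.div_lt_iff_lt_mul (by omega)]; omega
    exact Nat.le_one_iff_eq_zero_or_eq_one.1 (Nat.lt_succ_iff.1 this)
  constructor
  · rintro ⟨β, hβ⟩
    -- `B s` packs the truth values of half `s` into a number. For odd n the second half has an
    -- unused position, filled with `false`.
    let B : ℕ → ℕ := fun s => Nat.ofBits fun i : Fin h =>
      if hi : s * h + i < n then β ⟨s * h + i, hi⟩ else false
    have hB : ∀ s, B s < 2 ^ h := fun s => Nat.ofBits_lt_two_pow _
    have h0 := hB 0
    have h1 := hB 1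
    have hlit : ∀ (l : Fin n × Bool), β l.1 = l.2 →
        litTrue h (2 * B (l.1 / h) + l.1 / h) (code l) = true := by
      rintro ⟨v, b⟩ hl
      rw [litTrue_code]
      have hv := hdiv v
      have hlt : (v : ℕ) % h < h := Nat.mod_lt _ (by have := v.2; omega)
      have e : (2 * B ((v : ℕ) / h) + v / h) / 2 = B (v / h) := by omega
      refine ⟨by dsimp only; omega, ?_⟩
      dsimp only
      rw [e, Nat.testBit_ofBits_lt _ _ hlt]
      have e2 : (v : ℕ) / h * h + v % h = v := Nat.div_add_mod' v h
      simp only [e2, v.2, dif_pos]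
      exact hl
    refine ⟨⟨2 * B 0, by omega⟩, ⟨2 * B 1 + 1, by omega⟩, by simp, by simp, ?_⟩
    rintro c hc ⟨hx, hy⟩
    obtain ⟨l, hl, hβl⟩ := hβ _ (List.getElem_mem hc)
    rw [falsified, List.getD_eq_getElem _ _ hc, List.all_eq_true] at hx hy
    have h3 := hlit l hβl
    have hx' := hx l hl
    have hy' := hy l hl
    rcases hdiv l.1 with e | e <;> rw [e] at h3
    · simp only [Nat.add_zero] at h3
      simp [h3] at hx'
    · simp [h3] at hy'
  · rintro ⟨x, y, hx, hy, hxy⟩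
    refine ⟨fun v => if (v : ℕ) / h = 0 then (x / 2 : ℕ).testBit (v % h)
      else (y / 2 : ℕ).testBit (v % h), fun C hC => ?_⟩
    obtain ⟨c, hc, rfl⟩ := List.getElem_of_mem hC
    have hnot := hxy c hc
    rw [falsified, falsified, List.getD_eq_getElem _ _ hc, List.all_eq_true, List.all_eq_true,
      not_and_or] at hnot
    push Not at hnot
    rcases hnot with ⟨l, hl, ht⟩ | ⟨l, hl, ht⟩
    · have ht' : litTrue h x (code l) = true := by simpa using ht
      rw [litTrue_code, hx] at ht'
      exact ⟨l, hl, by simp only [ht'.1, if_true, ht'.2]⟩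
    · have ht' : litTrue h y (code l) = true := by simpa using ht
      rw [litTrue_code, hy] at ht'
      exact ⟨l, hl, by simp only [ht'.1, one_ne_zero, if_false, ht'.2]⟩

/-- The numbers which encode a clause. -/
def block (C : List (Fin n × Bool)) : List ℕ := C.length :: C.map code

/-- The position of clause `c` in the encoded formula. -/
def pos (φ : CnfFormula n) (c : ℕ) : ℕ := 2 + ((φ.take c).flatMap block).length

theorem encode_eq (φ : CnfFormula n) : φ.encode = n :: φ.length :: φ.flatMap block := rfl

theorem pos_succ (φ : CnfFormula n) {c : ℕ} (hc : c < φ.length) :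
    φ.pos (c + 1) = φ.pos c + 1 + φ[c].length := by
  simp only [pos, List.take_add_one, List.getElem?_eq_getElem hc, Option.toList_some,
    List.flatMap_append, List.length_append, List.flatMap_cons, List.flatMap_nil, block,
    List.length_cons, List.length_map, List.length_nil]
  omega

theorem encode_getD_pos_add (φ : CnfFormula n) {c : ℕ} (hc : c < φ.length) {i : ℕ}
    (hi : i ≤ φ[c].length) : φ.encode.getD (φ.pos c + i) 0 = (block φ[c]).getD i 0 := by
  have e : φ.encode = (n :: φ.length :: (φ.take c).flatMap block) ++
      (block φ[c] ++ (φ.drop (c + 1)).flatMap block) := by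
    rw [encode_eq, List.cons_append, List.cons_append, ← List.flatMap_cons, ← List.flatMap_append,
      ← List.drop_eq_getElem_cons hc, List.take_append_drop]
  have hl : (n :: φ.length :: (φ.take c).flatMap block).length = φ.pos c := by
    simp only [pos, List.length_cons]; omega
  rw [e, List.getD_append_right _ _ _ _ (by omega), hl, Nat.add_sub_cancel_left,
    List.getD_append _ _ _ _ (by simp [block]; omega)]

theorem length_flatMap_block_le {φ : CnfFormula n} {k : ℕ} (hk : ∀ C ∈ φ, C.length ≤ k) :
    (φ.flatMap block).length ≤ φ.length * (k + 1) := by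
  induction φ with
  | nil => simp
  | cons C φ ih =>
    have h1 := hk C (by simp)
    have h2 := ih fun C hC => hk C (by simp [hC])
    simp only [List.flatMap_cons, List.length_append, block, List.length_cons, List.length_map] at *
    linarith [add_mul φ.length 1 (k + 1)]

theorem pos_le {φ : CnfFormula n} {k : ℕ} (hk : ∀ C ∈ φ, C.length ≤ k) (c : ℕ) :
    φ.pos c ≤ φ.length * (k + 1) + 2 := by
  have h1 := length_flatMap_block_le hk
  have h2 : ((φ.take c).flatMap block).length ≤ (φ.flatMap block).length := by
    conv_rhs => rw [← List.take_append_drop c φ, List.flatMap_append, List.length_append]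
    omega
  unfold pos
  omega

theorem length_encode_le {φ : CnfFormula n} {k : ℕ} (hk : ∀ C ∈ φ, C.length ≤ k) :
    φ.encode.length ≤ φ.length * (k + 1) + 2 := by
  have h1 := length_flatMap_block_le hk
  rw [encode_eq]
  simpa using h1

theorem encode_le {φ : CnfFormula n} {k : ℕ} (hk : ∀ C ∈ φ, C.length ≤ k) :
    ∀ v ∈ φ.encode, v ≤ 2 * n + φ.length + k := by
  intro v hv
  rw [encode_eq] at hv
  simp only [List.mem_cons, List.mem_flatMap, block, List.mem_map] at hv
  rcases hv with rfl | rfl | ⟨C, hC, rfl | ⟨l, hl, rfl⟩⟩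
  · omega
  · omega
  · have := hk C hC; omega
  · have := l.1.2
    unfold code
    split_ifs <;> omega

end CnfFormula

/-! ## Construction of the instance of Diameter -/

namespace RedData

open RedVertex

variable {D : RedData} {W : ℕ} {full : List ℕ}

theorem mem_of_le {x c p : ℕ} {out : List ℕ} {a : ℕ} (ha : 8 ≤ a) : D.mem x c p out a =
    if a < D.F then D.inp.getD a 0
    else if a < D.F + 8 then D.inp.getD (a - D.F) 0 else out.getD (a - (D.F + 8)) 0 := by
  obtain ⟨b, rfl⟩ := Nat.exists_eq_add_of_le' ha
  rfl

/-- The entry of the original input at a computed position. -/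
def readInput (e : RamExpr) : RamExpr :=
  .read (.op .add e (.op .mul (.op .lt e (.lit 8)) (.op .sub (.reg 5) (.lit 8))))

/-- Registers 0 to 7 are in use, and their original contents lie from `F` on. Multiplying the test
for an address below 8 by the contents of register 5 minus 8, which is `F`, redirects exactly these
addresses. -/
theorem eval_readInput (hF : 8 ≤ D.F) {x c p : ℕ} {out : List ℕ} {e : RamExpr}
    (he : e.eval (D.mem x c p out) < D.F) :
    (readInput e).eval (D.mem x c p out) = D.inp.getD (e.eval (D.mem x c p out)) 0 := by
  have h5 : D.mem x c p out 5 = D.F + 8 := rfl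
  have h : (readInput e).eval (D.mem x c p out) = D.mem x c p out (e.eval (D.mem x c p out) +
      (if e.eval (D.mem x c p out) < 8 then 1 else 0) * (D.mem x c p out 5 - 8)) := rfl
  rw [h, h5, Nat.add_sub_cancel]
  generalize e.eval (D.mem x c p out) = v at he
  by_cases hv : v < 8
  · rw [if_pos hv, one_mul, mem_of_le (by omega), if_neg (by omega), if_pos (by omega),
      Nat.add_sub_cancel]
  · rw [if_neg hv, zero_mul, add_zero, mem_of_le (by omega), if_pos he]

/-- Whether the literal with the given code is true under the assignment in register `0`. -/
def litExpr (l : RamExpr) : RamExpr :=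
  .op .mul (.op .eq (.op .div (.op .div l (.lit 2)) (.reg 2)) (.op .mod (.reg 0) (.lit 2)))
    (.op .eq (.op .mod (.op .shr (.op .div (.reg 0) (.lit 2))
      (.op .mod (.op .div l (.lit 2)) (.reg 2))) (.lit 2)) (.op .mod l (.lit 2)))

theorem eval_litExpr {x c p : ℕ} {out : List ℕ} {l : RamExpr} :
    (litExpr l).eval (D.mem x c p out) =
      if CnfFormula.litTrue D.h x (l.eval (D.mem x c p out)) then 1 else 0 := by
  have h0 : D.mem x c p out 0 = x := rfl
  have h2 : D.mem x c p out 2 = D.h := rfl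
  simp only [litExpr, RamExpr.eval, RamOp.eval, h0, h2, CnfFormula.litTrue, decide_eq_true_eq]
  split_ifs <;> simp_all

/-- Whether none of the first `k` literals of the clause at the position in register `7` is true
under the assignment in register `0`. -/
def falsifiedExpr : ℕ → RamExpr
  | 0 => .lit 1
  | i + 1 => .op .mul (falsifiedExpr i) (.op .sub (.lit 1)
      (.op .mul (.op .lt (.lit i) (readInput (.reg 7)))
        (litExpr (readInput (.op .add (.reg 7) (.lit (i + 1)))))))

theorem noShl_falsifiedExpr : ∀ k, (falsifiedExpr k).NoShl
  | 0 => trivial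
  | k + 1 => by simp [falsifiedExpr, RamExpr.NoShl, noShl_falsifiedExpr k, readInput, litExpr]

/-- The number of the clause vertex joined to the subdivision vertex. -/
def targetExpr (k : ℕ) : RamExpr :=
  .op .add (.op .mul (falsifiedExpr k) (.reg 6))
    (.op .mul (.op .sub (.lit 1) (falsifiedExpr k)) (.op .add (.reg 1) (.op .mod (.reg 0) (.lit 2))))

/-- The number of assignment vertex `0`. -/
def assignBaseExpr : RamExpr := .op .add (.lit 13) (.reg 1)

/-- The number of the subdivision vertex. -/
def subExpr : RamExpr :=
  .op .add (.op .add (.op .add assignBaseExpr (.reg 3)) (.op .mul (.reg 6) (.reg 3))) (.reg 0)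

/-- The expressions for the initial part of the output. -/
def headExprs : List RamExpr :=
  [.op .add (.op .add assignBaseExpr (.reg 3)) (.op .mul (.reg 1) (.reg 3)),
    .op .add (.op .add (.op .add (.lit 18) (.reg 1)) (.reg 3))
      (.op .mul (.lit 3) (.op .mul (.reg 1) (.reg 3))), .lit 5, .lit 5] ++
    (coreEdges.flatMap fun e => [(e.1 : ℕ), (e.2 : ℕ)]).map .lit

/-- The edge at a clause vertex. -/
def clauseExprs : List RamExpr := [.lit 2, .op .add (.lit 11) (.reg 0)]

/-- The edge between an assignment vertex and its hub. -/
def assignExprs : List RamExpr :=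
  [.op .mul (.lit 4) (.op .mod (.reg 0) (.lit 2)), .op .add assignBaseExpr (.reg 0)]

/-- The edges at a subdivision vertex. -/
def subExprs (k : ℕ) : List RamExpr :=
  [.op .add (.lit 1) (.op .mul (.lit 2) (.op .mod (.reg 0) (.lit 2))), subExpr,
    .op .add assignBaseExpr (.reg 0), subExpr, .op .add (.lit 11) (targetExpr k), subExpr]

/-- Move on to the next clause. -/
def nextClause : RamProg :=
  .seq (.store (.lit 7) (.op .add (.op .add (.reg 7) (.lit 1)) (readInput (.reg 7))))
    (.store (.lit 6) (.op .add (.reg 6) (.lit 1)))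

/-- The program which writes the input for Diameter. -/
def construct (k : ℕ) : RamProg :=
  .seq (pushAll headExprs)
    (.seq (forX (.op .add (.reg 1) (.lit 2)) (pushAll clauseExprs))
      (.seq (forX (.reg 3) (pushAll assignExprs))
        (.loop (.op .lt (.reg 6) (.reg 1))
          (.seq (forX (.reg 3) (pushAll (subExprs k))) nextClause))))

/-- The parameters of the reduction for a formula with clauses of length at most `k`. -/
def ofFormula {n : ℕ} (k : ℕ) (φ : CnfFormula n) : RedData where
  inp := φ.encode
  M := φ.length
  h := (n + 1) / 2
  K := 2 * 2 ^ ((n + 1) / 2)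
  F := φ.length * (k + 1) + 10

/-- The input for Diameter which belongs to a formula. -/
def output {n : ℕ} (φ : CnfFormula n) : List ℕ :=
  input (φ.falsified ((n + 1) / 2)) φ.length (2 * 2 ^ ((n + 1) / 2))

section

variable {n k : ℕ} {φ : CnfFormula n}

theorem eval_length (hk : ∀ C ∈ φ, C.length ≤ k) {x c : ℕ} (hc : c < φ.length)
    (out : List ℕ) :
    (readInput (.reg 7)).eval ((ofFormula k φ).mem x c (φ.pos c) out) = φ[c].length := by
  have h := CnfFormula.pos_le hk c
  rw [eval_readInput (by simp [ofFormula])]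
  · exact (φ.encode_getD_pos_add hc (i := 0) (by omega)).trans rfl
  · exact lt_of_le_of_lt h (by simp [ofFormula])

/-- The product is unrolled over `i`. The factor testing `i` against the clause length makes
positions past the end of the clause irrelevant, whatever is read there. -/
theorem eval_falsifiedExpr (hk : ∀ C ∈ φ, C.length ≤ k) {x c : ℕ} (hc : c < φ.length)
    (out : List ℕ) (i : ℕ) :
    (falsifiedExpr i).eval ((ofFormula k φ).mem x c (φ.pos c) out) =
      if (φ[c].take i).all fun l => !CnfFormula.litTrue ((n + 1) / 2) x (CnfFormula.code l)
      then 1 else 0 := by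
  induction i with
  | zero => simp [falsifiedExpr, RamExpr.eval]
  | succ i ih =>
    have h1 : (falsifiedExpr (i + 1)).eval ((ofFormula k φ).mem x c (φ.pos c) out) =
        (falsifiedExpr i).eval ((ofFormula k φ).mem x c (φ.pos c) out) *
          (1 - (if i < φ[c].length then 1 else 0) *
            (litExpr (readInput (.op .add (.reg 7) (.lit (i + 1))))).eval
              ((ofFormula k φ).mem x c (φ.pos c) out)) := by
      rw [← eval_length hk hc out]
      rfl
    rw [h1, ih]
    by_cases hi : i < φ[c].length
    · have h7 : (RamExpr.op .add (.reg 7) (.lit (i + 1))).eval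
          ((ofFormula k φ).mem x c (φ.pos c) out) = φ.pos c + (i + 1) := rfl
      have hlt : φ.pos c + (i + 1) < (ofFormula k φ).F := by
        -- The literal lies before the start of the next clause, and that position is below `F`.
        have h2 := CnfFormula.pos_le hk (c + 1)
        rw [φ.pos_succ hc] at h2
        simp only [ofFormula]
        omega
      have hread : (readInput (.op .add (.reg 7) (.lit (i + 1)))).eval
          ((ofFormula k φ).mem x c (φ.pos c) out) = CnfFormula.code φ[c][i] := by
        rw [eval_readInput (by simp [ofFormula]) (by rw [h7]; exact hlt), h7]
        refine (φ.encode_getD_pos_add hc (by omega)).trans ?_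
        simp [CnfFormula.block, hi]
      rw [eval_litExpr, hread, if_pos hi, List.take_add_one, List.getElem?_eq_getElem hi]
      have hh : (ofFormula k φ).h = (n + 1) / 2 := rfl
      rw [hh]
      simp only [Option.toList_some, List.all_append, List.all_cons, List.all_nil, Bool.and_true]
      cases (List.take i φ[c]).all fun l =>
          !CnfFormula.litTrue ((n + 1) / 2) x (CnfFormula.code l) <;>
        cases CnfFormula.litTrue ((n + 1) / 2) x (CnfFormula.code φ[c][i]) <;> simp
    · rw [if_neg hi, zero_mul, Nat.sub_zero, mul_one, List.take_of_length_le (by omega),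
        List.take_of_length_le (by omega)]

theorem eval_targetExpr (hk : ∀ C ∈ φ, C.length ≤ k) {x c : ℕ} (hc : c < φ.length)
    (out : List ℕ) :
    (targetExpr k).eval ((ofFormula k φ).mem x c (φ.pos c) out) =
      target (φ.falsified ((n + 1) / 2)) φ.length c x := by
  have h1 : (targetExpr k).eval ((ofFormula k φ).mem x c (φ.pos c) out) =
      (falsifiedExpr k).eval ((ofFormula k φ).mem x c (φ.pos c) out) * c +
        (1 - (falsifiedExpr k).eval ((ofFormula k φ).mem x c (φ.pos c) out)) *
          (φ.length + x % 2) := rfl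
  rw [h1, eval_falsifiedExpr hk hc, List.take_of_length_le (hk _ (List.getElem_mem hc)), target,
    CnfFormula.falsified, List.getD_eq_getElem _ _ hc]
  split_ifs <;> simp

end

/-- A bound for the cost of `construct`. -/
def constructWeight (k : ℕ) : ℕ :=
  pushAllWeight headExprs +
    4 * (pushAllWeight clauseExprs +
      2 * (RamExpr.op .lt (.reg 0) (.op .add (.reg 1) (.lit 2))).weight + 40) +
    (pushAllWeight assignExprs + 2 * (RamExpr.op .lt (.reg 0) (.reg 3)).weight + 40) +
    (pushAllWeight (subExprs k) + 2 * (RamExpr.op .lt (.reg 0) (.reg 3)).weight + 40) +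
    2 * (RamExpr.op .lt (.reg 6) (.reg 1)).weight +
    (RamExpr.op .add (.op .add (.reg 7) (.lit 1)) (readInput (.reg 7))).weight + 100

theorem mem_update_six_seven (x c c' p p' : ℕ) (out : List ℕ) : D.mem x c' p' out =
    Function.update (Function.update (D.mem x c p out) 7 p') 6 c' := by
  funext a
  match a with
  | 6 => simp [mem]
  | 7 => simp [mem]
  | 0 | 1 | 2 | 3 | 4 | 5 | a + 8 =>
    rw [Function.update_of_ne (by omega), Function.update_of_ne (by omega)]
    rfl

theorem runs_nextClause {n k : ℕ} {φ : CnfFormula n} (hk : ∀ C ∈ φ, C.length ≤ k)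
    (hD : (ofFormula k φ).Bounded W full) {x c : ℕ} (hx : x < 2 ^ W) (hc : c < φ.length)
    {out : List ℕ} (hout : out <+: full) :
    nextClause.Runs ((ofFormula k φ).mem x c (φ.pos c) out)
      ((ofFormula k φ).mem x (c + 1) (φ.pos (c + 1)) out)
      (((RamExpr.op .add (.op .add (.reg 7) (.lit 1)) (readInput (.reg 7))).weight + 40) * W) := by
  have hW := hD.W_pos
  have hM : φ.length + 2 < 2 ^ W := hD.M_lt
  have hF : φ.length * (k + 1) + 10 + 8 < 2 ^ W := hD.F_lt
  have hp := CnfFormula.pos_le hk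
  have hb := hD.mem_lt hx (c := c) (p := φ.pos c) (by omega) (by have := hp c; omega) hout
  have e1 : (RamExpr.op .add (.op .add (.reg 7) (.lit 1)) (readInput (.reg 7))).eval
      ((ofFormula k φ).mem x c (φ.pos c) out) = φ.pos (c + 1) := by
    have := eval_length hk hc (x := x) out
    rw [φ.pos_succ hc, ← this]
    rfl
  have h1 := RamProg.runs_store_of_noShl (a := .lit 7)
    (e := .op .add (.op .add (.reg 7) (.lit 1)) (readInput (.reg 7))) hW hb trivial
    (by simp [RamExpr.NoShl, readInput]) rfl
  rw [e1] at h1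
  have h2 := RamProg.runs_store_of_noShl (a := .lit 6) (e := .op .add (.reg 6) (.lit 1)) hW
    (s := Function.update ((ofFormula k φ).mem x c (φ.pos c) out) 7 (φ.pos (c + 1)))
    (s' := (ofFormula k φ).mem x (c + 1) (φ.pos (c + 1)) out) ?_ trivial (by simp [RamExpr.NoShl])
    (mem_update_six_seven x c (c + 1) (φ.pos c) (φ.pos (c + 1)) out)
  · refine (h1.seq h2).mono ?_
    have w1 : (RamExpr.lit 7).weight = 4 := by decide
    have w2 : (RamExpr.lit 6).weight = 4 := by decide
    have w3 : (RamExpr.op .add (.reg 6) (.lit 1)).weight = 13 := by decide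
    rw [w1, w2, w3]
    nlinarith
  · intro a
    rw [Function.update_apply]
    split_ifs
    · have := hp (c + 1); omega
    · exact hb a

theorem runs_construct {n k : ℕ} {φ : CnfFormula n} (hk : ∀ C ∈ φ, C.length ≤ k)
    (hD : (ofFormula k φ).Bounded W (output φ)) :
    (construct k).Runs ((ofFormula k φ).mem 0 0 2 [])
      ((ofFormula k φ).mem (ofFormula k φ).K φ.length (φ.pos φ.length) (output φ))
      (constructWeight k * ((φ.length + 1) * (((ofFormula k φ).K + 1) * W))) := by
  have hW := hD.W_pos
  have hM : φ.length + 2 < 2 ^ W := hD.M_lt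
  have hF : φ.length * (k + 1) + 10 + 8 < 2 ^ W := hD.F_lt
  have hK := hD.K_lt
  have h0 : 0 < 2 ^ W := by positivity
  have hp : ∀ c, φ.pos c < 2 ^ W := fun c => by
    have := CnfFormula.pos_le hk c
    omega
  have hp2 : φ.pos 0 = 2 := by simp [CnfFormula.pos]
  have hp2' : 2 < 2 ^ W := hp2 ▸ hp 0
  set U := φ.falsified ((n + 1) / 2) with hU
  set K := (ofFormula k φ).K with hKdef
  set A := headBlock φ.length K with hA
  set B := (List.range (φ.length + 2)).flatMap (fun j => [2, 11 + j]) with hB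
  set C := (List.range K).flatMap (fun x => [4 * (x % 2), 13 + φ.length + x]) with hC
  set E : ℕ → List ℕ := fun c => (List.range K).flatMap fun x => subBlock U φ.length K c x with hE
  have hout : output φ = A ++ B ++ C ++ (List.range φ.length).flatMap E := rfl
  have hpre : ∀ c ≤ φ.length, A ++ B ++ C ++ (List.range c).flatMap E <+: output φ := fun c hc => by
    rw [hout]
    exact (List.prefix_append_right_inj _).2 (prefix_flatMap_range hc)
  have hpreC : A ++ B ++ C <+: output φ := ⟨_, hout.symm⟩
  have hpreB : A ++ B <+: output φ := (List.prefix_append _ _).trans hpreC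
  have hpreA : A <+: output φ := (List.prefix_append _ _).trans hpreB
  have r1 := runs_pushAll hD (x := 0) (c := 0) (p := 2) h0 h0 hp2' (es := headExprs) (vs := A) ?_
    (out := []) (by simpa using hpreA)
  have r2 := runs_forX hD (x₀ := 0) (c := 0) (p := 2) (n := φ.length + 2)
    (T := .op .add (.reg 1) (.lit 2)) h0 h0 hp2' hM (by simp [RamExpr.NoShl]) (fun _ _ => rfl)
    (body := pushAll clauseExprs) (g := fun j => [2, 11 + j]) (β := pushAllWeight clauseExprs)
    (fun x hx out ho => runs_pushAll hD (by omega) h0 hp2' (es := clauseExprs) (vs := [2, 11 + x])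
      (.cons ⟨trivial, fun _ => rfl⟩ (.cons ⟨by simp [RamExpr.NoShl], fun _ => rfl⟩ .nil)) ho)
    (out := A) hpreB
  have r3 := runs_forX hD (x₀ := φ.length + 2) (c := 0) (p := 2) (n := K)
    (T := .reg 3) hM h0 hp2' hK (by simp [RamExpr.NoShl]) (fun _ _ => rfl)
    (body := pushAll assignExprs) (g := fun x => [4 * (x % 2), 13 + φ.length + x])
    (β := pushAllWeight assignExprs)
    (fun x hx out ho => runs_pushAll hD (by omega) h0 hp2' (es := assignExprs)
      (vs := [4 * (x % 2), 13 + φ.length + x]) (.cons ⟨by simp [RamExpr.NoShl], fun _ => rfl⟩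
        (.cons ⟨by simp [RamExpr.NoShl, assignBaseExpr], fun _ => rfl⟩ .nil)) ho)
    (out := A ++ B) hpreC
  -- Invariant before round `c`: register 0 still holds `K` from the preceding inner loop, register
  -- 7 holds the position of clause `c`, and the blocks of all earlier clauses have been written.
  have r4 := RamProg.runs_loop (e := .op .lt (.reg 6) (.reg 1))
    (P := .seq (forX (.reg 3) (pushAll (subExprs k))) nextClause) (T := φ.length)
    (b := (RamExpr.op .lt (.reg 6) (.reg 1)).weight * W)
    (c := 1 + (K + 1) * ((pushAllWeight (subExprs k) +
      2 * (RamExpr.op .lt (.reg 0) (.reg 3)).weight + 40) * W) +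
      ((RamExpr.op .add (.op .add (.reg 7) (.lit 1)) (readInput (.reg 7))).weight + 40) * W)
    (fun c => (ofFormula k φ).mem K c (φ.pos c) (A ++ B ++ C ++ (List.range c).flatMap E)) ?_ ?_ ?_ ?_
  · simp only [List.range_zero, List.flatMap_nil, List.append_nil, hp2] at r4
    rw [List.nil_append] at r1
    have h := r1.seq (r2.seq (r3.seq r4))
    rw [hout]
    refine h.mono ?_
    -- Each phase costs a constant, depending on k only, times one of the four products compared
    -- here with the final bound.
    have w1 : W ≤ (φ.length + 1) * ((K + 1) * W) := by
      nlinarith [Nat.zero_le (φ.length * (K + 1) * W), Nat.zero_le (K * W)]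
    have w2 : φ.length * W ≤ (φ.length + 1) * ((K + 1) * W) := by
      nlinarith [Nat.zero_le (φ.length * K * W), Nat.zero_le (K * W)]
    have w3 : (K + 1) * W ≤ (φ.length + 1) * ((K + 1) * W) := by
      nlinarith [Nat.zero_le (φ.length * ((K + 1) * W))]
    have w4 : φ.length * ((K + 1) * W) ≤ (φ.length + 1) * ((K + 1) * W) := by
      nlinarith
    unfold constructWeight
    generalize (RamExpr.op .lt (.reg 0) (.op .add (.reg 1) (.lit 2))).weight = a1
    generalize (RamExpr.op .lt (.reg 0) (.reg 3)).weight = a2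
    generalize (RamExpr.op .lt (.reg 6) (.reg 1)).weight = a3
    generalize (RamExpr.op .add (.op .add (.reg 7) (.lit 1)) (readInput (.reg 7))).weight = a4
    generalize pushAllWeight headExprs = a5
    generalize pushAllWeight clauseExprs = a6
    generalize pushAllWeight assignExprs = a7
    generalize pushAllWeight (subExprs k) = a8
    generalize (φ.length + 1) * ((K + 1) * W) = X at *
    have v1 := Nat.mul_le_mul_left a5 w1
    have v2 := Nat.mul_le_mul_left (a6 + 2 * a1 + 40) (Nat.add_le_add w2 (Nat.mul_le_mul_left 2 w1))
    have v2' := Nat.mul_le_mul_left (a6 + 2 * a1 + 40) w1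
    have v3 := Nat.mul_le_mul_left (a7 + 2 * a2 + 40) w3
    have v4 := Nat.mul_le_mul_left (a8 + 2 * a2 + 40) w4
    have v5 := Nat.mul_le_mul_left (a3 + a4 + 40) w2
    have v6 := Nat.mul_le_mul_left a3 w1
    have v7 : φ.length ≤ X := (Nat.le_mul_of_pos_right _ hW).trans w2
    have v8 : 1 ≤ X := hW.trans w1
    linarith
  · intro c hc
    exact RamExpr.cost_le hW (hD.mem_lt hK (by omega) (hp c) (hpre c hc)) (by simp [RamExpr.NoShl])
  · intro c hc
    have : (RamExpr.op .lt (.reg 6) (.reg 1)).eval ((ofFormula k φ).mem K c (φ.pos c)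
      (A ++ B ++ C ++ (List.range c).flatMap E)) = if c < φ.length then 1 else 0 := rfl
    rw [this, if_pos hc]
    exact one_ne_zero
  · have : (RamExpr.op .lt (.reg 6) (.reg 1)).eval ((ofFormula k φ).mem K φ.length
      (φ.pos φ.length) (A ++ B ++ C ++ (List.range φ.length).flatMap E)) =
        if φ.length < φ.length then 1 else 0 := rfl
    rw [this, if_neg (lt_irrefl _)]
  · intro c hc
    have hpc := hpre (c + 1) hc
    rw [flatMap_range_succ, ← List.append_assoc] at hpc
    have r5 := runs_forX hD (x₀ := K) (c := c) (p := φ.pos c) (n := K)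
      (T := .reg 3) hK (by omega) (hp c) hK (by simp [RamExpr.NoShl]) (fun _ _ => rfl)
      (body := pushAll (subExprs k)) (g := fun x => subBlock U φ.length K c x)
      (β := pushAllWeight (subExprs k))
      (fun x hx out ho => runs_pushAll hD (by omega) (by omega) (hp c) ?_ ho) hpc
    · have r6 := runs_nextClause hk hD hK hc hpc
      have := r5.seq r6
      rw [flatMap_range_succ, ← List.append_assoc]
      exact this
    · have hs : subExpr.NoShl ∧ ∀ out, subExpr.eval ((ofFormula k φ).mem x c (φ.pos c) out) =
          13 + φ.length + K + c * K + x :=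
        ⟨by simp [RamExpr.NoShl, subExpr, assignBaseExpr], fun _ => rfl⟩
      refine .cons ⟨by simp [RamExpr.NoShl], fun _ => rfl⟩ (.cons hs
        (.cons ⟨by simp [RamExpr.NoShl, assignBaseExpr], fun _ => rfl⟩ (.cons hs
          (.cons ⟨by simp [RamExpr.NoShl, targetExpr, noShl_falsifiedExpr], fun out => ?_⟩
            (.cons hs .nil)))))
      exact congrArg (11 + ·) (eval_targetExpr hk hc out)
  · refine List.rel_append (.cons ⟨by simp [RamExpr.NoShl, assignBaseExpr], fun _ => rfl⟩
      (.cons ⟨by simp [RamExpr.NoShl], fun _ => rfl⟩ (.cons ⟨trivial, fun _ => rfl⟩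
        (.cons ⟨trivial, fun _ => rfl⟩ .nil)))) ?_
    rw [List.forall₂_map_left_iff, List.forall₂_same]
    exact fun _ _ => ⟨trivial, fun _ => rfl⟩

end RedData

/-! ## Saving the input -/

namespace RedData

open RedVertex

variable {W : ℕ}

/-- The address to which register `i` is saved. -/
def saveAddr (k i : ℕ) : RamExpr := .op .add (.op .mul (.reg 1) (.lit (k + 1))) (.lit (10 + i))

/-- Save the first `i` registers. -/
def save (k : ℕ) : ℕ → RamProg
  | 0 => .skip
  | i + 1 => .seq (save k i) (.store (saveAddr k i) (.reg i))

/-- A bound for the cost of `save`. -/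
def saveWeight (k : ℕ) : ℕ → ℕ
  | 0 => 1
  | i + 1 => saveWeight k i + (saveAddr k i).weight + (RamExpr.reg i).weight + 2

/-- The memory after the first `i` registers have been saved. -/
def savedMem (s : RamMem) (F i : ℕ) : RamMem := fun a =>
  if F ≤ a ∧ a < F + i then s (a - F) else s a

theorem savedMem_lt {s : RamMem} (hs : ∀ a, s a < 2 ^ W) (F i a : ℕ) :
    savedMem s F i a < 2 ^ W := by
  unfold savedMem
  split_ifs
  exacts [hs _, hs _]

/-- The target area begins at address 10 or later, so saving overwrites neither the registers still
to be saved nor register 1, from which the addresses are computed. -/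
theorem runs_save {s : RamMem} (hs : ∀ a, s a < 2 ^ W) (hW : 1 ≤ W) (k : ℕ) {i : ℕ} (hi : i ≤ 8) :
    (save k i).Runs s (savedMem s (s 1 * (k + 1) + 10) i) (saveWeight k i * W) := by
  induction i with
  | zero =>
    refine ⟨1, by simpa [saveWeight] using hW, ?_⟩
    have : savedMem s (s 1 * (k + 1) + 10) 0 = s := by
      funext a
      exact if_neg (by omega)
    rw [this]
    exact .skip s
  | succ i ih =>
    have h1 := RamProg.runs_store_of_noShl (a := saveAddr k i) (e := .reg i) hW
      (savedMem_lt hs (s 1 * (k + 1) + 10) i)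
      (s' := savedMem s (s 1 * (k + 1) + 10) (i + 1)) (by simp [RamExpr.NoShl, saveAddr]) trivial ?_
    · exact ((ih (by omega)).seq h1).mono (by simp only [saveWeight]; nlinarith)
    · have e1 : (saveAddr k i).eval (savedMem s (s 1 * (k + 1) + 10) i) =
          s 1 * (k + 1) + (10 + i) := by
        have : savedMem s (s 1 * (k + 1) + 10) i 1 = s 1 := if_neg (by omega)
        simp only [saveAddr, RamExpr.eval, RamOp.eval, this]
      have e2 : (RamExpr.reg i).eval (savedMem s (s 1 * (k + 1) + 10) i) = s i :=
        show savedMem s (s 1 * (k + 1) + 10) i i = s i from if_neg (by omega)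
      rw [e1, e2]
      generalize s 1 * (k + 1) = m
      funext a
      rw [Function.update_apply]
      unfold savedMem
      split_ifs with h2 h3 h4 h5
      · congr 1; omega
      · congr 1
      · omega
      · congr 1; omega
      · omega
      · rfl

/-- Initialize the registers. -/
def initRegs (k : ℕ) : RamProg :=
  .seq (.store (.lit 5) (saveAddr k 8))
    (.seq (.store (.lit 2) (.op .div (.op .add (.reg 0) (.lit 1)) (.lit 2)))
      (.seq (.store (.lit 3) (.op .shl (.lit 2) (.reg 2)))
        (.seq (.store (.lit 4) (.lit 0))
          (.seq (.store (.lit 6) (.lit 0))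
            (.seq (.store (.lit 7) (.lit 2)) (.store (.lit 0) (.lit 0)))))))

theorem runs_store_lit {s : RamMem} (hs : ∀ a, s a < 2 ^ W) (hW : 1 ≤ W) {i v : ℕ} {e : RamExpr}
    (he : e.NoShl) (hv : e.eval s = v) (hvW : v < 2 ^ W) :
    (RamProg.store (.lit i) e).Runs s (Function.update s i v) ((i.size + 2 + e.weight) * W) ∧
      ∀ a, Function.update s i v a < 2 ^ W := by
  subst hv
  refine ⟨(RamProg.runs_store_of_noShl (a := .lit i) hW hs trivial he rfl).mono
    (by simp only [RamExpr.weight]; nlinarith), fun a => ?_⟩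
  rw [Function.update_apply]
  split_ifs
  exacts [hvW, hs a]

theorem runs_initRegs {n k : ℕ} {φ : CnfFormula n} (hk : ∀ C ∈ φ, C.length ≤ k) {full : List ℕ}
    (hD : (ofFormula k φ).Bounded W full) :
    (initRegs k).Runs (savedMem (RamMem.ofInput φ.encode) (φ.length * (k + 1) + 10) 8)
      ((ofFormula k φ).mem 0 0 2 []) (((saveAddr k 8).weight + 100) * W) := by
  have hW := hD.W_pos
  have hF : φ.length * (k + 1) + 10 + 8 < 2 ^ W := hD.F_lt
  have hK : 2 * 2 ^ ((n + 1) / 2) < 2 ^ W := hD.K_lt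
  have hh : (n + 1) / 2 < 2 ^ W := hD.h_lt
  have hs : ∀ a, RamMem.ofInput φ.encode a < 2 ^ W := fun a => getD_lt hD.inp_lt a
  have h1 : RamMem.ofInput φ.encode 1 = φ.length := rfl
  have h0 : RamMem.ofInput φ.encode 0 = n := rfl
  have hF10 : 10 ≤ φ.length * (k + 1) + 10 := by omega
  have hlen := CnfFormula.length_encode_le hk
  have hb := savedMem_lt hs (φ.length * (k + 1) + 10) 8
  have hsm : ∀ a, a < 10 → savedMem (RamMem.ofInput φ.encode) (φ.length * (k + 1) + 10) 8 a =
      RamMem.ofInput φ.encode a := fun a ha => if_neg (by omega)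
  set s := savedMem (RamMem.ofInput φ.encode) (φ.length * (k + 1) + 10) 8 with hsdef
  have s0 : s 0 = n := hsm 0 (by norm_num)
  have s1 : s 1 = φ.length := hsm 1 (by norm_num)
  obtain ⟨r1, b1⟩ := runs_store_lit (i := 5) (e := saveAddr k 8)
    (v := φ.length * (k + 1) + 10 + 8) hb hW (by simp [RamExpr.NoShl, saveAddr])
    (by simp only [saveAddr, RamExpr.eval, RamOp.eval, s1]) hF
  obtain ⟨r2, b2⟩ := runs_store_lit (i := 2) (e := .op .div (.op .add (.reg 0) (.lit 1)) (.lit 2))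
    (v := (n + 1) / 2) b1 hW (by simp [RamExpr.NoShl])
    (by simp [RamExpr.eval, RamOp.eval, s0]) hh
  -- This is the only left shift in the reduction. Its cost is read off from the actual result,
  -- which is `K` and has at most `W` bits.
  have r3 : (RamProg.store (.lit 3) (.op .shl (.lit 2) (.reg 2))).Runs
      (Function.update (Function.update s 5 (φ.length * (k + 1) + 10 + 8)) 2 ((n + 1) / 2))
      (Function.update (Function.update (Function.update s 5 (φ.length * (k + 1) + 10 + 8)) 2
        ((n + 1) / 2)) 3 (2 * 2 ^ ((n + 1) / 2))) (20 * W) := by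
    refine RamProg.runs_store ?_ ?_
    · simp [RamExpr.eval, RamOp.eval, Nat.shiftLeft_eq]
    · simp only [RamExpr.eval, RamExpr.cost, RamOp.eval, Function.update_self, Nat.shiftLeft_eq]
      have e1 := Nat.size_le.2 hK
      have e2 := Nat.size_le.2 hh
      have e3 : Nat.size 3 = 2 := by decide
      have e4 : Nat.size 2 = 2 := by decide
      omega
  have b3 : ∀ a, Function.update (Function.update (Function.update s 5
      (φ.length * (k + 1) + 10 + 8)) 2 ((n + 1) / 2)) 3 (2 * 2 ^ ((n + 1) / 2)) a < 2 ^ W := by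
    intro a
    rw [Function.update_apply]
    split_ifs
    exacts [hK, b2 a]
  obtain ⟨r4, b4⟩ := runs_store_lit (i := 4) (e := .lit 0) (v := 0) b3 hW trivial rfl (by positivity)
  obtain ⟨r5, b5⟩ := runs_store_lit (i := 6) (e := .lit 0) (v := 0) b4 hW trivial rfl (by positivity)
  obtain ⟨r6, b6⟩ := runs_store_lit (i := 7) (e := .lit 2) (v := 2) b5 hW trivial rfl (by omega)
  obtain ⟨r7, b7⟩ := runs_store_lit (i := 0) (e := .lit 0) (v := 0) b6 hW trivial rfl (by positivity)
  have hfin : (ofFormula k φ).mem 0 0 2 [] = Function.update (Function.update (Function.update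
      (Function.update (Function.update (Function.update (Function.update s 5
        (φ.length * (k + 1) + 10 + 8)) 2 ((n + 1) / 2)) 3 (2 * 2 ^ ((n + 1) / 2))) 4 0) 6 0) 7 2) 0
          0 := by
    funext a
    match a with
    | 0 | 2 | 3 | 4 | 5 | 6 | 7 => simp [mem, ofFormula]
    | 1 => simp [mem, ofFormula, s1]
    | a + 8 =>
      rw [Function.update_of_ne (by omega), Function.update_of_ne (by omega),
        Function.update_of_ne (by omega), Function.update_of_ne (by omega),
        Function.update_of_ne (by omega), Function.update_of_ne (by omega),
        Function.update_of_ne (by omega), hsdef]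
      rw [mem_of_le (by omega)]
      change (if a + 8 < φ.length * (k + 1) + 10 then φ.encode.getD (a + 8) 0
        else if a + 8 < φ.length * (k + 1) + 10 + 8
          then φ.encode.getD (a + 8 - (φ.length * (k + 1) + 10)) 0
          else ([] : List ℕ).getD (a + 8 - (φ.length * (k + 1) + 10 + 8)) 0) =
        if φ.length * (k + 1) + 10 ≤ a + 8 ∧ a + 8 < φ.length * (k + 1) + 10 + 8
          then φ.encode.getD (a + 8 - (φ.length * (k + 1) + 10)) 0 else φ.encode.getD (a + 8) 0
      split_ifs
      · omega
      · rfl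
      · rfl
      · omega
      · omega
      -- The encoded formula ends before `F`, so the future output area contains only zeros.
      · rw [List.getD_nil, List.getD_eq_default _ _ (by omega)]
  rw [hfin]
  refine (r1.seq (r2.seq (r3.seq (r4.seq (r5.seq (r6.seq r7)))))).mono ?_
  have w1 : Nat.size 5 = 3 := by decide
  have w2 : Nat.size 2 = 2 := by decide
  have w3 : (RamExpr.op .div (.op .add (.reg 0) (.lit 1)) (.lit 2)).weight = 22 := by decide
  have w4 : Nat.size 4 = 3 := by decide
  have w5 : Nat.size 6 = 3 := by decide
  have w6 : Nat.size 7 = 3 := by decide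
  have w7 : Nat.size 0 = 0 := by decide
  have w8 : (RamExpr.lit 0).weight = 1 := by decide
  have w9 : (RamExpr.lit 2).weight = 3 := by decide
  rw [w1, w2, w3, w4, w5, w6, w7, w8, w9]
  nlinarith

/-- The program which replaces a formula by the input for Diameter. -/
def prepare (k : ℕ) : RamProg := .seq (save k 8) (.seq (initRegs k) (construct k))

/-- A bound for the cost of `prepare`. -/
def prepareWeight (k : ℕ) : ℕ :=
  saveWeight k 8 + (saveAddr k 8).weight + constructWeight k + 102

theorem runs_prepare {n k : ℕ} {φ : CnfFormula n} (hk : ∀ C ∈ φ, C.length ≤ k)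
    (hD : (ofFormula k φ).Bounded W (output φ)) :
    (prepare k).Runs (RamMem.ofInput φ.encode)
      ((ofFormula k φ).mem (ofFormula k φ).K φ.length (φ.pos φ.length) (output φ))
      (prepareWeight k * ((φ.length + 1) * (((ofFormula k φ).K + 1) * W))) := by
  have hW := hD.W_pos
  have h1 := runs_save (s := RamMem.ofInput φ.encode) (fun a => getD_lt hD.inp_lt a) hW k
    (i := 8) le_rfl
  have e : RamMem.ofInput φ.encode 1 = φ.length := rfl
  rw [e] at h1
  refine (h1.seq ((runs_initRegs hk hD).seq (runs_construct hk hD))).mono ?_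
  have w : W ≤ (φ.length + 1) * (((ofFormula k φ).K + 1) * W) := by
    generalize (ofFormula k φ).K = K
    nlinarith [Nat.zero_le (φ.length * (K + 1) * W), Nat.zero_le (K * W)]
  unfold prepareWeight
  generalize (φ.length + 1) * (((ofFormula k φ).K + 1) * W) = X at *
  have v1 := Nat.mul_le_mul_left (saveWeight k 8) w
  have v2 := Nat.mul_le_mul_left ((saveAddr k 8).weight + 100) w
  have v3 := hW.trans w
  linarith

/-! ## Bounds for the numbers that occur -/

theorem length_output {n : ℕ} (φ : CnfFormula n) :
    (output φ).length = 4 + 2 * edgeCount φ.length (2 * 2 ^ ((n + 1) / 2)) := by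
  simp [output, input, headBlock, subBlock, edgeCount, List.length_flatMap, coreEdges]
  ring

theorem le_of_mem_output {n : ℕ} (φ : CnfFormula n) :
    ∀ v ∈ output φ, v ≤ edgeCount φ.length (2 * 2 ^ ((n + 1) / 2)) := by
  intro v hv
  simp only [output] at hv
  generalize 2 * 2 ^ ((n + 1) / 2) = K at *
  have hcore : ∀ v ∈ coreEdges.flatMap fun e => [(e.1 : ℕ), (e.2 : ℕ)], v ≤ 10 := by decide
  simp only [input, headBlock, subBlock, List.mem_append, List.mem_flatMap, List.mem_range,
    List.mem_cons, List.not_mem_nil, or_false] at hv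
  have hcount : count φ.length K ≤ edgeCount φ.length K := by
    unfold count edgeCount
    omega
  rcases hv with (((hv | hv) | hv) | hv) | hv
  · have : 5 ≤ edgeCount φ.length K := by unfold edgeCount; omega
    omega
  · have := hcore v (by simpa only [List.mem_flatMap, List.mem_cons, List.not_mem_nil, or_false])
    unfold edgeCount
    omega
  · obtain ⟨j, hj, hv⟩ := hv
    unfold edgeCount
    omega
  · obtain ⟨x, hx, hv⟩ := hv
    unfold edgeCount
    omega
  · obtain ⟨c, hc, x, hx, hv⟩ := hv
    have h1 := mul_add_lt hc hx
    have h2 := target_lt (U := φ.falsified ((n + 1) / 2)) hc x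
    unfold edgeCount
    omega

theorem edgeCount_le (M h : ℕ) : edgeCount M (2 * 2 ^ h) ≤ 24 * ((M + 1) * 2 ^ h) := by
  have : 1 ≤ 2 ^ h := Nat.one_le_two_pow
  unfold edgeCount
  nlinarith [Nat.mul_le_mul_left M this]

/-- Everything that occurs is at most a small constant times 2^n · 2^M · 2^k, plus a small constant;
the 20 additional bits absorb these constants. -/
theorem bounded_ofFormula {n k : ℕ} {φ : CnfFormula n} (hk : ∀ C ∈ φ, C.length ≤ k) :
    (ofFormula k φ).Bounded (n + φ.length + k + 20) (output φ) := by
  have hw : n + φ.length + k < 2 ^ (n + φ.length + k) := Nat.lt_two_pow_self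
  have h20 : 2 ^ (n + φ.length + k + 20) = 1048576 * 2 ^ (n + φ.length + k) := by
    rw [pow_add]; ring
  have hM : φ.length + 1 ≤ 2 ^ φ.length := Nat.lt_two_pow_self
  have hk1 : k + 1 ≤ 2 ^ k := Nat.lt_two_pow_self
  have hh : 2 ^ ((n + 1) / 2) ≤ 2 * 2 ^ n := by
    rw [← pow_succ']
    exact Nat.pow_le_pow_right (by norm_num) (by omega)
  have hfact : 2 ^ (n + φ.length + k) = 2 ^ n * (2 ^ φ.length * 2 ^ k) := by
    rw [pow_add, pow_add, mul_assoc]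
  have hn1 : 1 ≤ 2 ^ n := Nat.one_le_two_pow
  have hM1 : 1 ≤ 2 ^ φ.length := Nat.one_le_two_pow
  have hkk : 1 ≤ 2 ^ k := Nat.one_le_two_pow
  have hE : edgeCount φ.length (2 * 2 ^ ((n + 1) / 2)) ≤ 48 * 2 ^ (n + φ.length + k) := by
    refine (edgeCount_le _ _).trans ?_
    calc 24 * ((φ.length + 1) * 2 ^ ((n + 1) / 2)) ≤ 24 * (2 ^ φ.length * (2 * 2 ^ n)) := by gcongr
      _ = 48 * (2 ^ n * (2 ^ φ.length * 1)) := by ring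
      _ ≤ 48 * 2 ^ (n + φ.length + k) := by rw [hfact]; gcongr
  have hMk : φ.length * (k + 1) ≤ 2 ^ (n + φ.length + k) := by
    calc φ.length * (k + 1) ≤ 2 ^ φ.length * 2 ^ k := by gcongr; omega
      _ = 1 * (2 ^ φ.length * 2 ^ k) := by ring
      _ ≤ 2 ^ (n + φ.length + k) := by rw [hfact]; gcongr
  have hnn : 2 ^ n ≤ 2 ^ (n + φ.length + k) := Nat.pow_le_pow_right (by norm_num) (by omega)
  refine ⟨fun v hv => ?_, ?_, ?_, ?_, ?_, by omega, fun v hv => ?_, ?_⟩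
  · have := CnfFormula.encode_le hk v hv
    omega
  · change φ.length + 2 < _
    omega
  · change (n + 1) / 2 < _
    omega
  · change 2 * 2 ^ ((n + 1) / 2) < _
    omega
  · change φ.length * (k + 1) + 10 + 8 < _
    omega
  · have := le_of_mem_output φ v hv
    omega
  · rw [length_output]
    omega

end RedData

/-! ## The lower bound -/

namespace RedData

open RedVertex

/-- Decide satisfiability by means of a program for Diameter. -/
def satProgram (k : ℕ) (P : RamProg) : RamProg :=
  .seq (prepare k) (.seq (P.shift 5)
    (.store (.lit 0) (.op .eq (.read (.reg 5)) (.lit 6))))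

theorem runs_satProgram {n k : ℕ} {φ : CnfFormula n} (hk : ∀ C ∈ φ, C.length ≤ k) {P : RamProg}
    {s : RamMem} {c : ℕ} (hP : RamExec P (RamMem.ofInput (output φ)) c s) (hs : s 0 ≤ 6) :
    ∃ t : RamMem, t 0 = (if s 0 = 6 then 1 else 0) ∧
      (satProgram k P).Runs (RamMem.ofInput φ.encode) t
        (prepareWeight k * ((φ.length + 1) *
            ((2 * 2 ^ ((n + 1) / 2) + 1) * (n + φ.length + k + 20))) +
          (4 * (n + φ.length + k + 20) + 18) * c + (n + φ.length + k + 50)) := by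
  have hD := bounded_ofFormula hk
  have h1 := runs_prepare hk hD
  have hF : φ.length * (k + 1) + 10 + 8 < 2 ^ (n + φ.length + k + 20) := hD.F_lt
  have hsize := Nat.size_le.2 hF
  -- From address `F + 8` on, the memory is the output followed by zeros, which is precisely an
  -- initial memory for the Diameter program; register 5 holds this base.
  have hemb : RamMem.Embeds 5 (φ.length * (k + 1) + 10 + 8) (RamMem.ofInput (output φ))
      ((ofFormula k φ).mem (ofFormula k φ).K φ.length (φ.pos φ.length) (output φ)) := by
    refine ⟨rfl, fun x => ?_⟩
    have hFeq : (ofFormula k φ).F = φ.length * (k + 1) + 10 := rfl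
    rw [mem_of_le (by omega), hFeq, if_neg (by omega), if_neg (by omega), Nat.add_sub_cancel_left]
    rfl
  obtain ⟨t, ht, h2⟩ := hP.shift (by omega) hemb
  have ht0 : t (φ.length * (k + 1) + 10 + 8) = s 0 := ht.2 0
  refine ⟨Function.update t 0 (if s 0 = 6 then 1 else 0), Function.update_self .., ?_⟩
  have h3 : (RamProg.store (.lit 0) (.op .eq (.read (.reg 5)) (.lit 6))).Runs t
      (Function.update t 0 (if s 0 = 6 then 1 else 0)) (n + φ.length + k + 20 + 20) := by
    refine RamProg.runs_store ?_ ?_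
    · have e : (RamExpr.op .eq (.read (.reg 5)) (.lit 6)).eval t = if t (t 5) = 6 then 1 else 0 := rfl
      rw [e, ht.1, ht0]
      rfl
    · have e : (RamExpr.lit 0).cost t = 1 := by simp [RamExpr.cost]
      have e' : (RamExpr.op .eq (.read (.reg 5)) (.lit 6)).cost t = (1 + Nat.size 5) +
          (1 + (t 5).size) + (1 + (t (t 5)).size) + (1 + Nat.size 6) +
            (1 + Nat.size (if t (t 5) = 6 then 1 else 0)) := rfl
      rw [e, e', ht.1, ht0]
      have e1 : Nat.size 5 = 3 := by decide
      have e2 : Nat.size 6 = 3 := by decide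
      have e3 : (s 0).size ≤ 3 := Nat.size_le.2 (by omega)
      have e4 : Nat.size (if s 0 = 6 then 1 else 0) ≤ 1 := by split_ifs <;> decide
      omega
  refine (h1.seq (h2.seq h3)).mono ?_
  have hKeq : (ofFormula k φ).K = 2 * 2 ^ ((n + 1) / 2) := rfl
  have e1 : Nat.size 5 = 3 := by decide
  rw [hKeq, e1]
  have : (4 * (φ.length * (k + 1) + 10 + 8).size + 2 * 3 + 12) * c ≤
      (4 * (n + φ.length + k + 20) + 18) * c := Nat.mul_le_mul_right c (by omega)
  omega

/-- A program for Diameter solves satisfiability. -/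
theorem exists_run_of_solvesDiameter {P : RamProg} {f : ℕ → ℕ → ℕ} {p : ℝ}
    (hP : SolvesDiameterAcnDom P f p) {n : ℕ} (φ : CnfFormula n) :
    ∃ (c : ℕ) (s : RamMem), RamExec P (RamMem.ofInput (output φ)) c s ∧
      (c : ℝ) ≤ (f 5 5 : ℝ) * ((count φ.length (2 * 2 ^ ((n + 1) / 2)) +
        edgeCount φ.length (2 * 2 ^ ((n + 1) / 2)) : ℕ) : ℝ) ^ p ∧
      s 0 ≤ 6 ∧ (s 0 = 6 ↔ φ.Satisfiable) := by
  have hK : 2 ≤ 2 * 2 ^ ((n + 1) / 2) := by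
    have : 1 ≤ 2 ^ ((n + 1) / 2) := Nat.one_le_two_pow
    omega
  obtain ⟨c, s, hexec, hc, hs⟩ := hP _ _ _
    (connected_numGraph (φ.falsified ((n + 1) / 2)) φ.length (2 * 2 ^ ((n + 1) / 2)))
    (isEdgeList_numEdgeList _ _ _)
  rw [encode_numGraph _ _ hK] at hexec
  rw [acyclicChromaticNumber_numGraph, dominationNumber_numGraph _ _ hK, length_numEdgeList] at hc
  rw [(numIso _ _ _).diam_eq] at hs
  refine ⟨c, s, hexec, hc, hs ▸ diam_graph_le_six _, ?_⟩
  -- Rounding n / 2 up guarantees that two halves cover all variables.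
  rw [hs, diam_graph_eq_six_iff, φ.satisfiable_iff (h := (n + 1) / 2) (by omega)]

theorem count_add_edgeCount_le (M h : ℕ) :
    count M (2 * 2 ^ h) + edgeCount M (2 * 2 ^ h) ≤ 48 * ((M + 1) * 2 ^ h) := by
  have h1 := edgeCount_le M h
  have h2 : count M (2 * 2 ^ h) ≤ edgeCount M (2 * 2 ^ h) := by
    unfold count edgeCount
    omega
  omega

theorem two_pow_half_le (n : ℕ) : ((2 : ℝ) ^ ((n + 1) / 2)) ≤ 2 * (2 : ℝ) ^ ((n : ℝ) / 2) := by
  have h1 : ((((n + 1) / 2 : ℕ)) : ℝ) ≤ 1 + (n : ℝ) / 2 := by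
    have : (((n + 1) / 2 : ℕ) : ℝ) ≤ ((n + 1 : ℕ) : ℝ) / (2 : ℕ) := Nat.cast_div_le
    push_cast at this
    linarith
  calc (2 : ℝ) ^ ((n + 1) / 2) = (2 : ℝ) ^ ((((n + 1) / 2 : ℕ)) : ℝ) := (Real.rpow_natCast _ _).symm
    _ ≤ (2 : ℝ) ^ (1 + (n : ℝ) / 2) := Real.rpow_le_rpow_of_exponent_le (by norm_num) h1
    _ = 2 * (2 : ℝ) ^ ((n : ℝ) / 2) := by rw [Real.rpow_add (by norm_num), Real.rpow_one]

/-- The size is at most 96 (M + 1) 2^(n/2), where 96 = 48 · 2 and the 2 comes from rounding up n /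
2. Raising 2^(n/2) to the power 2 - ε' gives the exponent (1 - ε'/2) n; for the polynomial factor
the power 2 suffices, and 9216 = 96². -/
theorem rpow_size_le (M n : ℕ) {ε ε' : ℝ} (hε : ε' ≤ ε) (h0 : 0 ≤ ε') (h1 : ε' ≤ 1) :
    ((count M (2 * 2 ^ ((n + 1) / 2)) + edgeCount M (2 * 2 ^ ((n + 1) / 2)) : ℕ) : ℝ) ^ (2 - ε) ≤
      9216 * ((M : ℝ) + 1) ^ 2 * (2 : ℝ) ^ ((1 - ε' / 2) * n) := by
  set Y := count M (2 * 2 ^ ((n + 1) / 2)) + edgeCount M (2 * 2 ^ ((n + 1) / 2)) with hY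
  have hY1 : (1 : ℝ) ≤ Y := by
    have : 1 ≤ Y := by
      rw [hY]
      unfold count
      omega
    exact_mod_cast this
  have hYle : (Y : ℝ) ≤ 96 * ((M : ℝ) + 1) * (2 : ℝ) ^ ((n : ℝ) / 2) := by
    have h2 : (Y : ℝ) ≤ 48 * (((M : ℝ) + 1) * 2 ^ ((n + 1) / 2)) := by
      exact_mod_cast count_add_edgeCount_le M ((n + 1) / 2)
    have h3 := two_pow_half_le n
    have hM : (0 : ℝ) ≤ (M : ℝ) + 1 := by positivity
    have h4 := mul_le_mul_of_nonneg_left h3 hM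
    nlinarith
  have hM1 : (1 : ℝ) ≤ 96 * ((M : ℝ) + 1) := by
    have : (0 : ℝ) ≤ M := by positivity
    linarith
  calc (Y : ℝ) ^ (2 - ε) ≤ (Y : ℝ) ^ (2 - ε') :=
        Real.rpow_le_rpow_of_exponent_le hY1 (by linarith)
    _ ≤ (96 * ((M : ℝ) + 1) * (2 : ℝ) ^ ((n : ℝ) / 2)) ^ (2 - ε') :=
        Real.rpow_le_rpow (by linarith) hYle (by linarith)
    _ = (96 * ((M : ℝ) + 1)) ^ (2 - ε') * (2 : ℝ) ^ ((1 - ε' / 2) * n) := by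
        rw [Real.mul_rpow (by linarith) (by positivity), ← Real.rpow_mul (by norm_num)]
        congr 2
        ring
    _ ≤ (96 * ((M : ℝ) + 1)) ^ (2 : ℝ) * (2 : ℝ) ^ ((1 - ε' / 2) * n) := by
        gcongr
        · linarith
    _ = 9216 * ((M : ℝ) + 1) ^ 2 * (2 : ℝ) ^ ((1 - ε' / 2) * n) := by
        rw [Real.rpow_two]
        ring

/-- The three summands of the constant belong to the construction, to the shifted Diameter program
and to the final comparison with 6. The exponent 3 arises from (M + 1)² in the size of the graph and
one factor for the address length. -/
theorem solvesKSat_satProgram {P : RamProg} {f : ℕ → ℕ → ℕ} {ε ε' : ℝ}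
    (hP : SolvesDiameterAcnDom P f (2 - ε)) (hε : ε' ≤ ε) (h0 : 0 ≤ ε') (h1 : ε' ≤ 1) (k : ℕ) :
    SolvesKSat (satProgram k P) k (1 - ε' / 2)
      (prepareWeight k * 5 * (k + 20) + (4 * (k + 20) + 18) * (f 5 5 * 9216) + (k + 50)) 3 := by
  intro n φ hk
  obtain ⟨c, s, hexec, hc, hs6, hsat⟩ := exists_run_of_solvesDiameter hP φ
  obtain ⟨t, ht, c', hc', hrun⟩ := runs_satProgram hk hexec hs6
  refine ⟨c', t, hrun, ?_, ?_⟩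
  · have hcR : (c' : ℝ) ≤ prepareWeight k * (((φ.length : ℝ) + 1) *
        ((2 * 2 ^ ((n + 1) / 2) + 1) * ((n : ℝ) + φ.length + k + 20))) +
          (4 * ((n : ℝ) + φ.length + k + 20) + 18) * c + ((n : ℝ) + φ.length + k + 50) := by
      exact_mod_cast hc'
    set E := (2 : ℝ) ^ ((1 - ε' / 2) * n) with hE
    set S := ((n + φ.length + 1 : ℕ) : ℝ) with hS
    have hSeq : S = n + φ.length + 1 := by rw [hS]; push_cast; ring
    have hn : (0 : ℝ) ≤ n := by positivity
    have hM : (0 : ℝ) ≤ φ.length := by positivity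
    have hkR : (0 : ℝ) ≤ k := by positivity
    have hS1 : 1 ≤ S := by rw [hSeq]; linarith
    have hMS : (φ.length : ℝ) + 1 ≤ S := by rw [hSeq]; linarith
    have hE1 : 1 ≤ E := Real.one_le_rpow (by norm_num) (mul_nonneg (by linarith) hn)
    have hc2 : (c : ℝ) ≤ f 5 5 * (9216 * S ^ 2 * E) := by
      refine hc.trans (mul_le_mul_of_nonneg_left ?_ (by positivity))
      refine (rpow_size_le φ.length n hε h0 h1).trans ?_
      gcongr
    have hK : (2 * 2 ^ ((n + 1) / 2) + 1 : ℝ) ≤ 5 * E := by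
      have h2 := two_pow_half_le n
      -- Here `ε' ≤ 1` is needed: the time 2^(n/2) for listing the assignments must not exceed
      -- 2^((1-ε'/2)n).
      have h3 : (2 : ℝ) ^ ((n : ℝ) / 2) ≤ E :=
        Real.rpow_le_rpow_of_exponent_le (by norm_num) (by nlinarith)
      linarith
    have hW : (n : ℝ) + φ.length + k + 20 ≤ (k + 20) * S := by
      rw [hSeq]; nlinarith
    have hW1 : 4 * ((n : ℝ) + φ.length + k + 20) + 18 ≤ (4 * (k + 20) + 18) * S := by nlinarith
    have hW2 : (n : ℝ) + φ.length + k + 50 ≤ (k + 50) * S := by nlinarith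
    have hS3 : S ^ 2 ≤ S ^ 3 := pow_le_pow_right₀ hS1 (by norm_num)
    have hS3' : S ≤ S ^ 3 := le_self_pow₀ hS1 (by norm_num)
    calc (c' : ℝ) ≤ _ := hcR
      _ ≤ prepareWeight k * (S * (5 * E * ((k + 20) * S))) +
          (4 * (k + 20) + 18) * S * (f 5 5 * (9216 * S ^ 2 * E)) + (k + 50) * S := by
        gcongr
      _ = prepareWeight k * 5 * (k + 20) * (E * S ^ 2) +
          (4 * (k + 20) + 18) * (f 5 5 * 9216) * (E * S ^ 3) + (k + 50) * (1 * S) := by ring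
      _ ≤ prepareWeight k * 5 * (k + 20) * (E * S ^ 3) +
          (4 * (k + 20) + 18) * (f 5 5 * 9216) * (E * S ^ 3) + (k + 50) * (E * S ^ 3) := by
        gcongr
      _ = _ := by push_cast; ring
  · rw [ht]
    by_cases h : φ.Satisfiable
    · rw [if_pos h, if_pos (hsat.2 h)]
    · rw [if_neg h, if_neg (mt hsat.1 h)]

end RedData

theorem mainTheorem4 (hSETH : StrongExponentialTimeHypothesis)
    (f : ℕ → ℕ → ℕ) (hf : Computable₂ f) (ε : ℝ) (hε : 0 < ε) :
    ¬ ∃ P : RamProg, SolvesDiameterAcnDom P f (2 - ε) := by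
  rintro ⟨P, hP⟩
  -- Truncating ε at 1 keeps the exponent 2 - ε' nonnegative and the construction time within the
  -- bound, while 1 - ε'/2 stays below 1.
  have h0 : 0 < min ε 1 := lt_min hε one_pos
  obtain ⟨k, hk⟩ := hSETH (1 - min ε 1 / 2) (by linarith)
  exact hk ⟨_, _, _, RedData.solvesKSat_satProgram hP (min_le_left _ _) h0.le (min_le_right _ _) k⟩
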